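/- Let $\bar{\mathbb F}_2$ be an algebraic closure of the field $\mathbb F_2$ with two elements, and let $\sigma=\sum_{k\ge 1} a_k t^k\in\mathbb F_2[[t]]$ be an element of the Nottingham group over $\mathbb F_2$, i.e. a power series with $a_1=1$ and zero constant term. Suppose that $\sigma$ is algebraic over $\mathbb F_2(t)$ and that $\sigma$ is sparse, i.e. that there is a real number $r\ge 0$ such that $$\#\{k\in\{0,1,\dots,N\} : a_k=1\}=O\big((\log N)^r\big)\qquad (N\to\infty).$$ Fix an algebraic closure of $\bar{\mathbb F}_2((t))$, and inside it let $$\mathcal F=\bigcup_{\ell\ge 1,\ \ell\text{ odd}}\bar{\mathbb F}_2(t^{1/\ell}).$$ Regard $\sigma$ as an element of $\bar{\mathbb F}_2((t))$. Then the following hold: 1. $\sigma$ is integral over $\bar{\mathbb F}_2[t,t^{-1}]$; 2. the field extension $\bar{\mathbb F}_2(t)(\sigma)/\bar{\mathbb F}_2(t)$ is unramified outside $0$ and $\infty$, i.e. every place $P$ of $\bar{\mathbb F}_2(t)(\sigma)$ over $\bar{\mathbb F}_2$ with $v_P(t)=0$ has ramification index $1$ over $\bar{\mathbb F}_2(t)$;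 3. the splitting field over $\mathcal F$ of the minimal polynomial of $\sigma$ over $\mathcal F$ has degree $2^n$ over $\mathcal F$ for some integer $n\ge 0$. -/

import Mathlib

noncomputable section

namespace SparseSeries

open Asymptotics Filter

/-- Membership in the Nottingham group over `𝔽₂`: power series of the form `t + a₂ t² + a₃ t³ + ⋯`. -/
def IsNottingham (σ : PowerSeries (ZMod 2)) : Prop :=
  PowerSeries.coeff 0 σ = 0 ∧ PowerSeries.coeff 1 σ = 1

/-- The number of elements of the support `E(σ) = {k | a_k = 1}` in `{0, 1, …, N}`. -/
def supportCount (σ : PowerSeries (ZMod 2)) (N : ℕ) : ℕ :=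
  ((Finset.range (N + 1)).filter fun k => PowerSeries.coeff k σ = 1).card

/-- `σ` is sparse: `#(E(σ) ∩ {0, …, N}) = O((log N)^r)` for some real `r ≥ 0`. -/
def IsSparse (σ : PowerSeries (ZMod 2)) : Prop :=
  ∃ r : ℝ, 0 ≤ r ∧
    (fun N : ℕ => (supportCount σ N : ℝ)) =O[atTop] (fun N : ℕ => Real.log (N : ℝ) ^ r)

/-- The inclusion `k(t) ⊆ k((t))`: the expansion of a rational function as a Laurent series,
extending the inclusion `k[t] ⊆ k((t))`. -/
instance ratFuncAlgebraLaurentSeries (k : Type*) [Field k] :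
    Algebra (RatFunc k) (LaurentSeries k) :=
  RatFunc.liftAlgebra k (LaurentSeries k)

theorem algebraMap_ratFunc_X (k : Type*) [Field k] :
    algebraMap (RatFunc k) (LaurentSeries k) RatFunc.X = HahnSeries.single 1 1 :=
  RatFunc.coe_X

section Places

variable (k : Type*) [Field k] {L : Type*} [Field L] [Algebra (RatFunc k) L]

/-- A place of the extension `L` of `k(t)`, trivial on `k`, given by its valuation ring:
a valuation ring `O` of `L` with `k ⊊ O ⊊ L`. -/
def IsPlace (O : ValuationSubring L) : Prop :=
  ((algebraMap (RatFunc k) L).comp (RatFunc.C (K := k))).range < O.toSubring ∧ O ≠ ⊤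

/-- The ramification index of `O` over a subfield `K`: the index of the value group `v(Kˣ)` in the
value group `v(Lˣ)` (with value `0` if this index is infinite). -/
def ramificationIndex (K : Type*) [Field K] {L : Type*} [Field L] [Algebra K L]
    (O : ValuationSubring L) : ℕ :=
  (Units.map ((O.valuation : L →* O.ValueGroup).comp (algebraMap K L : K →* L))).range.index

variable (L) in
/-- `L / k(t)` is unramified outside `0` and `∞`: every place `P` of `L` that lies neither above
`t = 0` (that is, `v_P(t) > 0`) nor above `t = ∞` (that is, `v_P(t) < 0`) has ramification
index `1` over `k(t)`. In Mathlib's multiplicative notation `v_P(t) = 0` reads `v t = 1`. -/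
def IsUnramifiedOutsideZeroInfty : Prop :=
  ∀ O : ValuationSubring L, IsPlace k O →
    O.valuation (algebraMap (RatFunc k) L RatFunc.X) = 1 →
    ramificationIndex (RatFunc k) O = 1

end Places

section Fields

variable (k : Type*) [Field k]

/-- The ring `k[t, t⁻¹]`, as a subring of `k((t))`. -/
def laurentPolynomials : Subalgebra k (LaurentSeries k) :=
  Algebra.adjoin k {HahnSeries.single (1 : ℤ) (1 : k), HahnSeries.single (-1 : ℤ) (1 : k)}

/-- The field `k(t^{1/ℓ} : ℓ odd)`, the union over all odd `ℓ ≥ 1` of the fields `k(t^{1/ℓ})`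
inside an algebraic closure of `k((t))`. Here `k(t^{1/ℓ})` is generated by all `ℓ`-th roots of `t`;
one of them is enough when `k` is algebraically closed, since two of them differ by a root of unity
in `k`. That the supremum is the union is shown in `mem_oddRootField`. -/
def oddRootField : IntermediateField (RatFunc k) (AlgebraicClosure (LaurentSeries k)) :=
  ⨆ ℓ : {ℓ : ℕ // Odd ℓ}, IntermediateField.adjoin (RatFunc k)
    {x : AlgebraicClosure (LaurentSeries k) | x ^ (ℓ : ℕ) = algebraMap (RatFunc k) _ RatFunc.X}

theorem mem_oddRootField (x : AlgebraicClosure (LaurentSeries k)) :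
    x ∈ oddRootField k ↔ ∃ ℓ : ℕ, Odd ℓ ∧ x ∈ IntermediateField.adjoin (RatFunc k)
      {y : AlgebraicClosure (LaurentSeries k) | y ^ ℓ = algebraMap (RatFunc k) _ RatFunc.X} := by
  have key : ∀ a b : ℕ, Odd b → IntermediateField.adjoin (RatFunc k)
      {y : AlgebraicClosure (LaurentSeries k) | y ^ a = algebraMap (RatFunc k) _ RatFunc.X} ≤
      IntermediateField.adjoin (RatFunc k)
      {y : AlgebraicClosure (LaurentSeries k) |
        y ^ (a * b) = algebraMap (RatFunc k) _ RatFunc.X} := by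
    intro a b hb
    rw [IntermediateField.adjoin_le_iff]
    intro y hy
    obtain ⟨z, hz⟩ := IsAlgClosed.exists_pow_nat_eq y hb.pos
    have hmem : z ∈ IntermediateField.adjoin (RatFunc k)
        {y : AlgebraicClosure (LaurentSeries k) |
          y ^ (a * b) = algebraMap (RatFunc k) _ RatFunc.X} := by
      apply IntermediateField.subset_adjoin
      rw [Set.mem_ofPred_eq, mul_comm, pow_mul, hz]
      exact hy
    rw [SetLike.mem_coe, ← hz]
    exact pow_mem hmem b
  have : Nonempty {ℓ : ℕ // Odd ℓ} := ⟨⟨1, odd_one⟩⟩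
  rw [oddRootField, ← SetLike.mem_coe, IntermediateField.coe_iSup_of_directed]
  · simp
  · intro a b
    refine ⟨⟨a * b, a.2.mul b.2⟩, key a b b.2, ?_⟩
    simpa only [mul_comm] using key b a a.2

end Fields

/-- A power series over `𝔽₂`, regarded as an element of `k((t))` for an extension `k` of `𝔽₂`. -/
def toLaurent (k : Type*) [Field k] [Algebra (ZMod 2) k] (σ : PowerSeries (ZMod 2)) :
    LaurentSeries k :=
  HahnSeries.ofPowerSeries ℤ k (PowerSeries.map (algebraMap (ZMod 2) k) σ)

end SparseSeries

end

noncomputable section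

namespace SparseSeries

section SparseStructure

open PowerSeries

/-! ### Cartier operators on `𝔽₂⟦t⟧` -/

/-! Sparseness forces `σ` to be built from `0` by sums, squares, multiplication by `t` and solving
equations `f = t ^ a f ^ 2 ^ d + h` with `d ≥ 1` (`InArtinSchreierTower`). By Christol's argument an
algebraic series has a finite 2-kernel (`finite_twoKernel_of_isAlgebraic`). If two different Cartier
operators of one length fixed a nonzero kernel element, its support would grow exponentially in the
number of binary digits, against sparseness (`HasPolynomialCount.eq_of_cartier_eq`). So the loops
through a kernel element are powers of a single one, and induction on the size of the kernel yields
the tower (`inArtinSchreierTower_of_hasPolynomialCount`). The three claims follow by induction along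
the tower. 1. Dividing by `t ^ a` makes the equation monic over `k[t, t⁻¹]`. 2. At a place with
`v(t) = 0`, the map `y ↦ t ^ a y ^ 2 ^ d + h` contracts towards `f`, so `f` is a limit of rational
functions and the value group does not grow (`mem_approximable_of_eq`). 3. Two solutions differ by
some `δ` with `δ = t ^ a δ ^ 2 ^ d`, which is zero or the inverse of a `(2 ^ d - 1)`-th root of `t ^
a`, hence lies in `oddRootField`. An automorphism fixing `h` thus translates `f` by a constant, and
its square fixes `f`. The Galois group is therefore a 2-group. -/

theorem coeff_pow_two_pow (f : (ZMod 2)⟦X⟧) (d n : ℕ) :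
    coeff n (f ^ 2 ^ d) = if 2 ^ d ∣ n then coeff (n / 2 ^ d) f else 0 := by
  -- The tail only affects degrees above `n`; for the truncation the power is `Polynomial.expand`,
  -- Frobenius being trivial on `𝔽₂`.
  have hsplit := f.eq_X_pow_mul_shift_add_trunc (n + 1)
  set g : (ZMod 2)⟦X⟧ := PowerSeries.mk fun i => coeff (i + (n + 1)) f
  have : CharP (ZMod 2)⟦X⟧ 2 := charP_of_injective_algebraMap (algebraMap (ZMod 2) _).injective 2
  have hpoly : (trunc (n + 1) f) ^ 2 ^ d = Polynomial.expand (ZMod 2) (2 ^ d) (trunc (n + 1) f) := by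
    rw [← Polynomial.map_iterateFrobenius_expand 2 (trunc (n + 1) f) d]
    have : iterateFrobenius (ZMod 2) 2 d = RingHom.id _ := Subsingleton.elim _ _
    rw [this, Polynomial.map_id]
  have h1 : coeff n (f ^ 2 ^ d) = coeff n (((trunc (n + 1) f) ^ 2 ^ d : Polynomial (ZMod 2)) : (ZMod 2)⟦X⟧) := by
    conv_lhs => rw [hsplit]
    rw [add_pow_char_pow, mul_pow, ← pow_mul, map_add, coeff_X_pow_mul', if_neg, zero_add,
      Polynomial.coe_pow]
    have : 0 < 2 ^ d := by positivity
    nlinarith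
  rw [h1, Polynomial.coeff_coe, hpoly, Polynomial.coeff_expand (by positivity)]
  split_ifs with h
  · rw [coeff_trunc, if_pos]
    exact Nat.lt_succ_of_le (Nat.div_le_self _ _)
  · rfl

/-- The Cartier operator extracting the coefficients with index congruent to `r` modulo `2 ^ d`. -/
def cartier (d r : ℕ) (f : (ZMod 2)⟦X⟧) : (ZMod 2)⟦X⟧ :=
  PowerSeries.mk fun n => coeff (2 ^ d * n + r) f

@[simp]
theorem coeff_cartier (d r n : ℕ) (f : (ZMod 2)⟦X⟧) :
    coeff n (cartier d r f) = coeff (2 ^ d * n + r) f :=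
  coeff_mk _ _

theorem cartier_cartier (d r e s : ℕ) (f : (ZMod 2)⟦X⟧) :
    cartier e s (cartier d r f) = cartier (d + e) (r + 2 ^ d * s) f := by
  ext n
  simp only [coeff_cartier]
  congr 2
  ring

theorem cartier_zero_zero (f : (ZMod 2)⟦X⟧) : cartier 0 0 f = f := by
  ext n
  simp

theorem cartier_zero (d r : ℕ) : cartier d r 0 = 0 := by
  ext n
  simp

theorem cartier_sum {ι : Type*} (d r : ℕ) (s : Finset ι) (f : ι → (ZMod 2)⟦X⟧) :
    cartier d r (∑ i ∈ s, f i) = ∑ i ∈ s, cartier d r (f i) := by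
  ext n
  simp

theorem sum_X_pow_mul_cartier (d : ℕ) (f : (ZMod 2)⟦X⟧) :
    f = ∑ r ∈ Finset.range (2 ^ d), X ^ r * cartier d r f ^ 2 ^ d := by
  have hd : 0 < 2 ^ d := by positivity
  ext n
  rw [map_sum, Finset.sum_eq_single (n % 2 ^ d)]
  · rw [coeff_X_pow_mul', if_pos (Nat.mod_le _ _), coeff_pow_two_pow, if_pos (Nat.dvd_sub_mod n),
      coeff_cartier, Nat.mul_div_cancel' (Nat.dvd_sub_mod n), Nat.sub_add_cancel (Nat.mod_le _ _)]
  · intro r hr hne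
    rw [coeff_X_pow_mul']
    split_ifs with h
    · rw [coeff_pow_two_pow, if_neg]
      intro hdvd
      apply hne
      have h2 : r ≡ n [MOD 2 ^ d] := (Nat.modEq_iff_dvd' h).2 hdvd
      rw [← Nat.mod_eq_of_lt (Finset.mem_range.1 hr)]
      exact h2
    · rfl
  · intro h
    exact absurd (Finset.mem_range.2 (Nat.mod_lt _ hd)) h

/-- Since `g ^ 2 ^ d` is a series in `t ^ 2 ^ d`, it leaves each residue class of indices in place.
This semilinearity lets Cartier operators strip Frobenius powers. -/
theorem cartier_pow_mul {d r : ℕ} (hr : r < 2 ^ d) (g f : (ZMod 2)⟦X⟧) :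
    cartier d r (g ^ 2 ^ d * f) = g * cartier d r f := by
  ext n
  rw [coeff_cartier, coeff_mul, coeff_mul]
  simp only [coeff_pow_two_pow, coeff_cartier, ite_mul, zero_mul]
  rw [← Finset.sum_filter]
  have hd : 0 < 2 ^ d := by positivity
  symm
  apply Finset.sum_of_injOn (fun p : ℕ × ℕ => (2 ^ d * p.1, 2 ^ d * p.2 + r))
  · intro p _ q _ h
    simp only [Prod.mk.injEq, Nat.add_right_cancel_iff] at h
    exact Prod.ext (Nat.eq_of_mul_eq_mul_left hd h.1) (Nat.eq_of_mul_eq_mul_left hd h.2)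
  · intro p hp
    have hp' := Finset.HasAntidiagonal.mem_antidiagonal.1 (Finset.mem_coe.1 hp)
    rw [Finset.mem_coe, Finset.mem_filter, Finset.HasAntidiagonal.mem_antidiagonal]
    exact ⟨by rw [← hp']; ring, Dvd.intro _ rfl⟩
  · intro p hp hne
    exfalso
    obtain ⟨h1, i, hi⟩ := Finset.mem_filter.1 hp
    have h1 := Finset.HasAntidiagonal.mem_antidiagonal.1 h1
    rw [hi] at h1
    have hin : i ≤ n := by
      by_contra! h
      have := Nat.mul_le_mul_left (2 ^ d) (Nat.succ_le_of_lt h)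
      rw [Nat.mul_succ] at this
      omega
    obtain ⟨j, rfl⟩ := Nat.exists_eq_add_of_le hin
    refine hne ⟨(i, j), ?_, ?_⟩
    · simp
    · refine Prod.ext hi.symm ?_
      have := Nat.mul_add (2 ^ d) i j
      simp only
      omega
  · intro p hp
    simp

/-! ### Algebraic series have a finite 2-kernel -/

/-- The power series `x` with `b x = ∑ i < n, dᵢ σ ^ 2 ^ i` for polynomials `dᵢ` of degree `< D`. -/
def boundedRelationSet (σ b : (ZMod 2)⟦X⟧) (n D : ℕ) : Set (ZMod 2)⟦X⟧ :=
  {x | ∃ p : Fin (n + 1) → (ZMod 2)⟦X⟧, (∀ i, ∀ j, D ≤ j → coeff j (p i) = 0) ∧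
    b * x = ∑ i, p i * σ ^ 2 ^ (i : ℕ)}

theorem finite_setOf_coeff_eq_zero (D : ℕ) :
    {p : (ZMod 2)⟦X⟧ | ∀ j, D ≤ j → coeff j p = 0}.Finite := by
  apply Set.Finite.of_injOn (f := fun p (j : Fin D) => coeff (j : ℕ) p) (t := Set.univ)
    (fun _ _ => Set.mem_univ _) _ Set.finite_univ
  intro p hp q hq h
  ext j
  by_cases hj : j < D
  · exact congrFun h ⟨j, hj⟩
  · rw [hp j (not_lt.1 hj), hq j (not_lt.1 hj)]

theorem finite_boundedRelationSet (σ : (ZMod 2)⟦X⟧) {b : (ZMod 2)⟦X⟧} (hb : b ≠ 0) (n D : ℕ) :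
    (boundedRelationSet σ b n D).Finite := by
  have hfin := Set.Finite.pi' (ι := Fin (n + 1)) fun _ => finite_setOf_coeff_eq_zero D
  refine ((hfin.image fun p : Fin (n + 1) → (ZMod 2)⟦X⟧ => ∑ i, p i * σ ^ 2 ^ (i : ℕ)).preimage (f := fun x => b * x)
    (mul_right_injective₀ hb).injOn).subset ?_
  rintro x ⟨p, hp, hx⟩
  exact ⟨p, hp, hx.symm⟩

theorem coeff_mul_eq_zero_of_le {p q : (ZMod 2)⟦X⟧} {D E : ℕ} (hp : ∀ j, D ≤ j → coeff j p = 0)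
    (hq : ∀ j, E ≤ j → coeff j q = 0) (j : ℕ) (hj : D + E ≤ j) : coeff j (p * q) = 0 := by
  rw [coeff_mul]
  refine Finset.sum_eq_zero fun x hx => ?_
  have := Finset.HasAntidiagonal.mem_antidiagonal.1 hx
  by_cases h : D ≤ x.1
  · rw [hp _ h, zero_mul]
  · rw [hq _ (by omega), mul_zero]

/-- In `b ^ 2 x` the term `b σ` can be replaced by `hrel`, after which only powers of `σ ^ 2` occur
and the operator removes one Frobenius. The new coefficients vanish from degree `2 D` on, and
halving indices restores the bound `D`. -/
theorem cartier_mem_boundedRelationSet {σ b : (ZMod 2)⟦X⟧} {n D : ℕ} (c : Fin n → (ZMod 2)⟦X⟧)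
    (hbD : ∀ j, D ≤ j → coeff j b = 0) (hcD : ∀ i, ∀ j, D ≤ j → coeff j (c i) = 0)
    (hrel : b * σ = ∑ i, c i * σ ^ 2 ^ (i + 1 : ℕ)) {x : (ZMod 2)⟦X⟧}
    (hx : x ∈ boundedRelationSet σ b n D) {r : ℕ} (hr : r < 2) :
    cartier 1 r x ∈ boundedRelationSet σ b n D := by
  obtain ⟨p, hp, hpx⟩ := hx
  have hr' : r < 2 ^ 1 := hr
  have hcar : ∀ i : Fin n, ∀ j, D ≤ j →
      coeff j (cartier 1 r (p 0 * c i + b * p i.succ)) = 0 := by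
    intro i j hj
    rw [coeff_cartier, map_add, coeff_mul_eq_zero_of_le (hp 0) (hcD i) _ (by omega),
      coeff_mul_eq_zero_of_le hbD (hp i.succ) _ (by omega), add_zero]
  refine ⟨Fin.snoc (fun i => cartier 1 r (p 0 * c i + b * p i.succ)) 0, ?_, ?_⟩
  · intro i
    refine Fin.lastCases ?_ (fun i => ?_) i
    · simp
    · simpa using hcar i
  · rw [Fin.sum_univ_castSucc]
    simp only [Fin.snoc_castSucc, Fin.snoc_last, zero_mul, add_zero, Fin.val_castSucc]
    rw [← cartier_pow_mul hr', pow_one, pow_two, mul_assoc, hpx, Fin.sum_univ_succ]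
    have h : b * (p 0 * σ ^ 2 ^ ((0 : Fin (n + 1)) : ℕ) +
        ∑ i : Fin n, p i.succ * σ ^ 2 ^ ((i.succ : Fin (n + 1)) : ℕ)) =
        ∑ i : Fin n, (σ ^ 2 ^ (i : ℕ)) ^ 2 ^ 1 * (p 0 * c i + b * p i.succ) := by
      have h0 : b * (p 0 * σ ^ 2 ^ ((0 : Fin (n + 1)) : ℕ)) = p 0 * (b * σ) := by
        simp only [Fin.val_zero, pow_zero, pow_one]
        ring
      rw [mul_add, h0, hrel, Finset.mul_sum, Finset.mul_sum, ← Finset.sum_add_distrib]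
      refine Finset.sum_congr rfl fun i _ => ?_
      rw [← pow_mul, ← pow_add, Fin.val_succ]
      ring
    rw [h, cartier_sum]
    refine Finset.sum_congr rfl fun i _ => ?_
    rw [cartier_pow_mul hr', mul_comm]

/-- The `2`-kernel of a power series: all its images under Cartier operators. -/
def twoKernel (f : (ZMod 2)⟦X⟧) : Set (ZMod 2)⟦X⟧ :=
  {g | ∃ d r, r < 2 ^ d ∧ cartier d r f = g}

theorem self_mem_twoKernel (f : (ZMod 2)⟦X⟧) : f ∈ twoKernel f :=
  ⟨0, 0, by simp, cartier_zero_zero f⟩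

theorem twoKernel_subset {f g : (ZMod 2)⟦X⟧} (h : g ∈ twoKernel f) : twoKernel g ⊆ twoKernel f := by
  obtain ⟨d, r, hr, rfl⟩ := h
  rintro _ ⟨e, s, hs, rfl⟩
  refine ⟨d + e, r + 2 ^ d * s, ?_, (cartier_cartier _ _ _ _ _).symm⟩
  rw [pow_add]
  nlinarith

theorem twoKernel_subset_of_forall_cartier_mem {S : Set (ZMod 2)⟦X⟧}
    (hS : ∀ x ∈ S, ∀ r < 2, cartier 1 r x ∈ S) {f : (ZMod 2)⟦X⟧} (hf : f ∈ S) :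
    twoKernel f ⊆ S := by
  rintro _ ⟨d, r, hr, rfl⟩
  induction d generalizing r with
  | zero =>
    obtain rfl : r = 0 := by simpa using hr
    rwa [cartier_zero_zero]
  | succ d ih =>
    have hd : 0 < 2 ^ d := by positivity
    have h := hS _ (ih (r % 2 ^ d) (Nat.mod_lt _ hd)) (r / 2 ^ d)
      (Nat.div_lt_of_lt_mul (by rwa [pow_succ] at hr))
    rwa [cartier_cartier, Nat.mod_add_div] at h

/-- A nontrivial relation between the iterated Frobenius images of `σ` with polynomial coefficients
can be chosen to involve `σ` itself. -/
theorem exists_relation_ne_zero (σ : (ZMod 2)⟦X⟧) (n D : ℕ) (c : Fin n → (ZMod 2)⟦X⟧)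
    (hc : c ≠ 0) (hcD : ∀ i, ∀ j, D ≤ j → coeff j (c i) = 0)
    (hrel : ∑ i, c i * σ ^ 2 ^ (i : ℕ) = 0) :
    ∃ (m : ℕ) (b : (ZMod 2)⟦X⟧) (c : Fin m → (ZMod 2)⟦X⟧), b ≠ 0 ∧
      (∀ j, D ≤ j → coeff j b = 0) ∧ (∀ i, ∀ j, D ≤ j → coeff j (c i) = 0) ∧
      b * σ = ∑ i, c i * σ ^ 2 ^ (i + 1 : ℕ) := by
  induction n with
  | zero => exact absurd (Subsingleton.elim _ _) hc
  | succ n ih =>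
    rw [Fin.sum_univ_succ] at hrel
    simp only [Fin.val_zero, pow_zero, pow_one, Fin.val_succ] at hrel
    have : CharP (ZMod 2)⟦X⟧ 2 :=
      charP_of_injective_algebraMap (algebraMap (ZMod 2) _).injective 2
    by_cases h0 : c 0 = 0
    · rw [h0, zero_mul, zero_add] at hrel
      obtain ⟨i, hi⟩ : ∃ i : Fin n, c i.succ ≠ 0 := by
        by_contra! h
        exact hc (funext fun i => Fin.cases h0 h i)
      -- All remaining powers of `σ` are squares, so a Cartier operator that does not kill every
      -- coefficient gives a shorter nontrivial relation.
      obtain ⟨r, hr, hri⟩ : ∃ r < 2, cartier 1 r (c i.succ) ≠ 0 := by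
        by_contra! h
        apply hi
        rw [sum_X_pow_mul_cartier 1 (c i.succ)]
        refine Finset.sum_eq_zero fun r hr => ?_
        rw [h r (Finset.mem_range.1 hr), zero_pow (by norm_num), mul_zero]
      refine ih (fun i => cartier 1 r (c i.succ)) (fun h => hri (congrFun h i)) ?_ ?_
      · intro i j hj
        rw [coeff_cartier, hcD _ _ (by omega)]
      · rw [← cartier_zero 1 r, ← hrel, cartier_sum]
        refine Finset.sum_congr rfl fun i _ => ?_
        rw [mul_comm, ← cartier_pow_mul (d := 1) hr, pow_one, ← pow_mul, ← pow_succ, mul_comm]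
    · refine ⟨n, c 0, fun i => c i.succ, h0, hcD 0, fun i => hcD _, ?_⟩
      rwa [CharTwo.add_eq_zero] at hrel

instance ratFuncSMulLaurentSeries (k : Type*) [Field k] : SMul (RatFunc k) (LaurentSeries k) :=
  Algebra.toSMul

instance polynomialScalarTowerLaurentSeries (k : Type*) [Field k] :
    IsScalarTower (Polynomial k) (RatFunc k) (LaurentSeries k) :=
  RatFunc.isScalarTower_liftAlgebra k (LaurentSeries k)

/-- The Frobenius powers of `σ` all lie in one finite-dimensional space; passing to the fraction
ring clears denominators. -/
theorem exists_relation_of_isAlgebraic {σ : (ZMod 2)⟦X⟧}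
    (halg : IsAlgebraic (RatFunc (ZMod 2)) (HahnSeries.ofPowerSeries ℤ (ZMod 2) σ)) :
    ∃ (n : ℕ) (c : Fin n → Polynomial (ZMod 2)), c ≠ 0 ∧
      ∑ i, (c i : (ZMod 2)⟦X⟧) * σ ^ 2 ^ (i : ℕ) = 0 := by
  set y := HahnSeries.ofPowerSeries ℤ (ZMod 2) σ
  have hfin := (IntermediateField.adjoin.finiteDimensional halg.isIntegral)
  set E := IntermediateField.adjoin (RatFunc (ZMod 2)) {y}
  set n := Module.finrank (RatFunc (ZMod 2)) E
  have hy : y ∈ E := IntermediateField.mem_adjoin_simple_self _ y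
  have hdep : ¬ LinearIndependent (RatFunc (ZMod 2)) (fun i : Fin (n + 1) => y ^ 2 ^ (i : ℕ)) := by
    intro hli
    have hli' : LinearIndependent (RatFunc (ZMod 2))
        (fun i : Fin (n + 1) => (⟨y, hy⟩ : E) ^ 2 ^ (i : ℕ)) :=
      LinearIndependent.of_comp E.val.toLinearMap hli
    have := hli'.fintype_card_le_finrank
    rw [Fintype.card_fin] at this
    omega
  rw [← LinearIndependent.iff_fractionRing (R := Polynomial (ZMod 2)),
    Fintype.not_linearIndependent_iff] at hdep
  obtain ⟨g, hg, i, hi⟩ := hdep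
  refine ⟨n + 1, g, fun h => hi (congrFun h i), ?_⟩
  apply HahnSeries.ofPowerSeries_injective (Γ := ℤ)
  rw [map_sum, map_zero, ← hg]
  refine Finset.sum_congr rfl fun j _ => ?_
  rw [Algebra.smul_def, map_mul, map_pow]
  rfl

theorem finite_twoKernel_of_isAlgebraic {σ : (ZMod 2)⟦X⟧}
    (halg : IsAlgebraic (RatFunc (ZMod 2)) (HahnSeries.ofPowerSeries ℤ (ZMod 2) σ)) :
    (twoKernel σ).Finite := by
  obtain ⟨n, c, hc, hrel⟩ := exists_relation_of_isAlgebraic halg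
  have hcD : ∀ i, ∀ j, (∑ i, (c i).natDegree) + 1 ≤ j → coeff j (c i : (ZMod 2)⟦X⟧) = 0 := by
    intro i j hj
    rw [Polynomial.coeff_coe]
    apply Polynomial.coeff_eq_zero_of_natDegree_lt
    have := Finset.single_le_sum (f := fun i => (c i).natDegree) (fun _ _ => Nat.zero_le _)
      (Finset.mem_univ i)
    omega
  obtain ⟨m, b, c', hb, hbD, hcD', hrel'⟩ := exists_relation_ne_zero σ n _
    (fun i => (c i : (ZMod 2)⟦X⟧))
    (fun h => hc (funext fun i => Polynomial.coe_injective _ (by simpa using congrFun h i)))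
    hcD hrel
  refine (finite_boundedRelationSet σ hb m (∑ i, (c i).natDegree + 1)).subset
    (twoKernel_subset_of_forall_cartier_mem (fun x hx r hr =>
      cartier_mem_boundedRelationSet c' hbD hcD' hrel' hx hr) ?_)
  -- The trivial relation `b σ = b σ` puts `σ` itself into the stable finite set.
  refine ⟨Fin.cons b fun _ => 0, ?_, ?_⟩
  · intro i
    refine Fin.cases hbD (fun i => ?_) i
    simp
  · rw [Fin.sum_univ_succ]
    simp

/-! ### Sparseness -/

/-- The number of nonzero coefficients with index less than `N`. -/
def countBelow (f : (ZMod 2)⟦X⟧) (N : ℕ) : ℕ :=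
  ((Finset.range N).filter fun n => coeff n f ≠ 0).card

/-- The number of nonzero coefficients of index less than `2 ^ m` is polynomially bounded in `m`. -/
def HasPolynomialCount (f : (ZMod 2)⟦X⟧) : Prop :=
  ∃ C R : ℕ, ∀ m, countBelow f (2 ^ m) ≤ C * (m + 1) ^ R

theorem countBelow_cartier_le {d r : ℕ} (hr : r < 2 ^ d) (f : (ZMod 2)⟦X⟧) (N : ℕ) :
    countBelow (cartier d r f) N ≤ countBelow f (2 ^ d * N) := by
  refine Finset.card_le_card_of_injOn (fun n => 2 ^ d * n + r) ?_ ?_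
  · intro n hn
    simp only [Finset.coe_filter, Finset.mem_range, coeff_cartier, Set.mem_ofPred_eq] at hn ⊢
    exact ⟨by nlinarith, hn.2⟩
  · intro a _ b _ h
    simpa using h

theorem HasPolynomialCount.cartier {f : (ZMod 2)⟦X⟧} (hf : HasPolynomialCount f) {d r : ℕ}
    (hr : r < 2 ^ d) : HasPolynomialCount (cartier d r f) := by
  obtain ⟨C, R, h⟩ := hf
  refine ⟨C * (d + 1) ^ R, R, fun m => ?_⟩
  calc countBelow (SparseSeries.cartier d r f) (2 ^ m) ≤ countBelow f (2 ^ d * 2 ^ m) :=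
        countBelow_cartier_le hr f _
    _ ≤ C * (d + m + 1) ^ R := by rw [← pow_add]; exact h _
    _ ≤ C * ((d + 1) * (m + 1)) ^ R := by gcongr; nlinarith
    _ = C * (d + 1) ^ R * (m + 1) ^ R := by rw [mul_pow, mul_assoc]

/-- A nonzero series with polynomial count is fixed by at most one Cartier operator of given
length. -/
theorem HasPolynomialCount.eq_of_cartier_eq {f : (ZMod 2)⟦X⟧} (hf : HasPolynomialCount f)
    (h0 : f ≠ 0) {d r s : ℕ} (hr : r < 2 ^ d) (hs : s < 2 ^ d) (hfr : SparseSeries.cartier d r f = f)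
    (hfs : SparseSeries.cartier d s f = f) : r = s := by
  by_contra hne
  -- Each of the two loops places a copy of the support below `N` in its own residue class modulo `2
  -- ^ d`, and these copies are disjoint.
  have hdouble : ∀ N, 2 * countBelow f N ≤ countBelow f (2 ^ d * N) := by
    intro N
    have hinj : ∀ r : ℕ, Function.Injective fun n => 2 ^ d * n + r := fun r a b h => by simpa using h
    have himg : ∀ r, r < 2 ^ d → SparseSeries.cartier d r f = f →
        ((Finset.range N).filter fun n => coeff n f ≠ 0).image (fun n => 2 ^ d * n + r) ⊆
        (Finset.range (2 ^ d * N)).filter fun n => coeff n f ≠ 0 := by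
      intro r hr hfr n hn
      obtain ⟨a, ha, rfl⟩ := Finset.mem_image.1 hn
      rw [← hfr] at ha
      simp only [Finset.mem_filter, Finset.mem_range, coeff_cartier] at ha ⊢
      exact ⟨by nlinarith, ha.2⟩
    have hdisj : Disjoint
        (((Finset.range N).filter fun n => coeff n f ≠ 0).image (fun n => 2 ^ d * n + r))
        (((Finset.range N).filter fun n => coeff n f ≠ 0).image (fun n => 2 ^ d * n + s)) := by
      rw [Finset.disjoint_left]
      intro n hn hn'
      obtain ⟨a, -, rfl⟩ := Finset.mem_image.1 hn
      obtain ⟨b, -, hb⟩ := Finset.mem_image.1 hn'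
      apply hne
      have := congrArg (· % 2 ^ d) hb
      simpa [Nat.mul_add_mod, Nat.mod_eq_of_lt hr, Nat.mod_eq_of_lt hs, eq_comm] using this
    have := Finset.card_le_card (Finset.union_subset (himg r hr hfr) (himg s hs hfs))
    rw [Finset.card_union_of_disjoint hdisj, Finset.card_image_of_injective _ (hinj r),
      Finset.card_image_of_injective _ (hinj s)] at this
    rw [countBelow, countBelow]
    omega
  obtain ⟨n, hn⟩ : ∃ n, coeff n f ≠ 0 := by
    by_contra! h
    exact h0 (PowerSeries.ext (by simpa using h))
  have hpow : ∀ m, 2 ^ m ≤ countBelow f (2 ^ (d * m + n)) := by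
    intro m
    induction m with
    | zero =>
      rw [pow_zero, Nat.one_le_iff_ne_zero, ← Nat.pos_iff_ne_zero, countBelow, Finset.card_pos]
      exact ⟨n, Finset.mem_filter.2 ⟨Finset.mem_range.2 (by simpa using Nat.lt_two_pow_self), hn⟩⟩
    | succ m ih =>
      calc 2 ^ (m + 1) = 2 * 2 ^ m := by ring
        _ ≤ 2 * countBelow f (2 ^ (d * m + n)) := by omega
        _ ≤ countBelow f (2 ^ d * 2 ^ (d * m + n)) := hdouble _
        _ = countBelow f (2 ^ (d * (m + 1) + n)) := by congr 1; ring
  obtain ⟨C, R, hC⟩ := hf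
  have hbound : ∀ m, 2 ^ m ≤ C * (d + n + 1) ^ R * (m + 1) ^ R := fun m => calc
    2 ^ m ≤ C * (d * m + n + 1) ^ R := (hpow m).trans (hC _)
    _ ≤ C * ((d + n + 1) * (m + 1)) ^ R := by gcongr; nlinarith
    _ = _ := by rw [mul_pow, mul_assoc]
  have hlim := tendsto_pow_const_div_const_pow_of_one_lt R (one_lt_two (α := ℝ))
  set B := C * (d + n + 1) ^ R
  have hev := (hlim.comp (Filter.tendsto_add_atTop_nat 1)).eventually
    (gt_mem_nhds (show (0 : ℝ) < 1 / (2 * (B + 1)) by positivity))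
  obtain ⟨m, hm⟩ := hev.exists
  have h1 : (2 : ℝ) ^ m ≤ B * (m + 1) ^ R := by exact_mod_cast hbound m
  simp only [Function.comp_apply] at hm
  rw [div_lt_div_iff₀ (by positivity) (by positivity), pow_succ] at hm
  push_cast at hm
  have : (0 : ℝ) < (m + 1 : ℝ) ^ R := by positivity
  nlinarith

theorem IsSparse.hasPolynomialCount {σ : (ZMod 2)⟦X⟧} (h : IsSparse σ) : HasPolynomialCount σ := by
  obtain ⟨r, hr, h⟩ := h
  obtain ⟨c, hc⟩ := h.bound
  obtain ⟨N, hN⟩ := Filter.eventually_atTop.1 hc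
  have hle : ∀ M, countBelow σ M ≤ supportCount σ M := by
    intro M
    apply Finset.card_le_card
    intro n hn
    simp only [Finset.mem_filter, Finset.mem_range] at hn ⊢
    refine ⟨by omega, ?_⟩
    have : ∀ x : ZMod 2, x ≠ 0 → x = 1 := by decide
    exact this _ hn.2
  -- The summand `2 ^ N` covers those `m` with `2 ^ m < N`, where the asymptotic bound is not
  -- available.
  refine ⟨⌈|c|⌉₊ + 2 ^ N, ⌈r⌉₊, fun m => ?_⟩
  have h1 : 1 ≤ (m + 1) ^ ⌈r⌉₊ := Nat.one_le_pow _ _ (by omega)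
  by_cases hm : N ≤ 2 ^ m
  · have h2 := hN _ hm
    rw [Real.norm_natCast, Real.norm_eq_abs, Nat.cast_pow, Nat.cast_ofNat, Real.log_pow] at h2
    have hlog : (m : ℝ) * Real.log 2 ≤ m + 1 := by
      have := Real.log_two_lt_d9
      have hm0 : (0 : ℝ) ≤ m := by positivity
      nlinarith
    have hlog0 : 0 ≤ (m : ℝ) * Real.log 2 := by positivity
    have h3 : |((m : ℝ) * Real.log 2) ^ r| ≤ ((m + 1) ^ ⌈r⌉₊ : ℝ) := by
      rw [abs_of_nonneg (by positivity), ← Real.rpow_natCast]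
      calc _ ≤ ((m : ℝ) + 1) ^ r := Real.rpow_le_rpow hlog0 hlog hr
        _ ≤ _ := Real.rpow_le_rpow_of_exponent_le (by linarith [m.cast_nonneg (α := ℝ)])
          (Nat.le_ceil r)
    have h4 : (countBelow σ (2 ^ m) : ℝ) ≤ (⌈|c|⌉₊ : ℝ) * (m + 1) ^ ⌈r⌉₊ := calc
      (countBelow σ (2 ^ m) : ℝ) ≤ supportCount σ (2 ^ m) := by exact_mod_cast hle _
      _ ≤ c * |((m : ℝ) * Real.log 2) ^ r| := h2
      _ ≤ |c| * |((m : ℝ) * Real.log 2) ^ r| := by gcongr; exact le_abs_self c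
      _ ≤ _ := by gcongr; exact Nat.le_ceil _
    have h5 : countBelow σ (2 ^ m) ≤ ⌈|c|⌉₊ * (m + 1) ^ ⌈r⌉₊ := by exact_mod_cast h4
    rw [add_mul]
    exact h5.trans (Nat.le_add_right _ _)
  · have h2 : countBelow σ (2 ^ m) ≤ 2 ^ m :=
      (Finset.card_filter_le _ _).trans_eq (Finset.card_range _)
    have h3 : N < 2 ^ N := Nat.lt_two_pow_self
    nlinarith [Nat.zero_le ⌈|c|⌉₊]

/-! ### Structure of sparse algebraic series -/

/-- The smallest class of series that contains `0` and is stable under addition, squaring,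
multiplication by `t` and solving equations `f = t ^ a f ^ 2 ^ d + h` with `d ≥ 1`. -/
inductive InArtinSchreierTower : (ZMod 2)⟦X⟧ → Prop
  | zero : InArtinSchreierTower 0
  | add {f g : (ZMod 2)⟦X⟧} : InArtinSchreierTower f → InArtinSchreierTower g →
      InArtinSchreierTower (f + g)
  | sq {f : (ZMod 2)⟦X⟧} : InArtinSchreierTower f → InArtinSchreierTower (f ^ 2)
  | X_mul {f : (ZMod 2)⟦X⟧} : InArtinSchreierTower f → InArtinSchreierTower (X * f)
  | root {f h : (ZMod 2)⟦X⟧} (a : ℕ) {d : ℕ} : d ≠ 0 → InArtinSchreierTower h →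
      f = X ^ a * f ^ 2 ^ d + h → InArtinSchreierTower f

theorem InArtinSchreierTower.sum {ι : Type*} {s : Finset ι} {f : ι → (ZMod 2)⟦X⟧}
    (h : ∀ i ∈ s, InArtinSchreierTower (f i)) : InArtinSchreierTower (∑ i ∈ s, f i) :=
  Finset.sum_induction _ _ (fun _ _ => add) zero h

theorem InArtinSchreierTower.pow_two_pow {f : (ZMod 2)⟦X⟧} (h : InArtinSchreierTower f) (d : ℕ) :
    InArtinSchreierTower (f ^ 2 ^ d) := by
  induction d with
  | zero => simpa using h
  | succ d ih => rw [pow_succ, pow_mul]; exact ih.sq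

theorem InArtinSchreierTower.X_pow_mul {f : (ZMod 2)⟦X⟧} (h : InArtinSchreierTower f) (a : ℕ) :
    InArtinSchreierTower (X ^ a * f) := by
  induction a with
  | zero => simpa using h
  | succ a ih => rw [pow_succ', mul_assoc]; exact ih.X_mul

/-- Repeating a loop keeps its lowest digits, so loops of different lengths can be compared at a
common length. -/
theorem cartier_iterate {f : (ZMod 2)⟦X⟧} {d r : ℕ} (hr : r < 2 ^ d) (hf : cartier d r f = f)
    (n : ℕ) : ∃ s, s < 2 ^ (d * n) ∧ (n ≠ 0 → s % 2 ^ d = r) ∧ cartier (d * n) s f = f := by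
  induction n with
  | zero => exact ⟨0, by simp, by simp, by simpa using cartier_zero_zero f⟩
  | succ n ih =>
    obtain ⟨s, hs, -, hsf⟩ := ih
    refine ⟨r + 2 ^ d * s, ?_, fun _ => ?_, ?_⟩
    · rw [Nat.mul_succ, pow_add]
      nlinarith
    · rw [Nat.add_mul_mod_self_left, Nat.mod_eq_of_lt hr]
    · conv_rhs => rw [← hsf]
      conv_rhs => rw [← hf]
      rw [cartier_cartier]
      congr 1
      ring

/-- Strong induction on the size of the kernel: a Cartier image from which `f` cannot be recovered
has a strictly smaller kernel. If `f` lies on a loop, the residue of the loop gives the term `t ^ r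
f ^ 2 ^ d`, and no other residue leads back to `f`. -/
theorem inArtinSchreierTower_of_hasPolynomialCount {f : (ZMod 2)⟦X⟧} (hfin : (twoKernel f).Finite)
    (hf : HasPolynomialCount f) : InArtinSchreierTower f := by
  induction hn : (twoKernel f).ncard using Nat.strong_induction_on generalizing f with
  | _ n ih =>
  subst hn
  by_cases h0 : f = 0
  · rw [h0]; exact .zero
  have hlower : ∀ d r, r < 2 ^ d → f ∉ twoKernel (cartier d r f) →
      InArtinSchreierTower (cartier d r f) := by
    intro d r hr hnot
    have hsub : twoKernel (cartier d r f) ⊆ twoKernel f := twoKernel_subset ⟨d, r, hr, rfl⟩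
    exact ih _ (Set.ncard_lt_ncard ⟨hsub, fun h => hnot (h (self_mem_twoKernel f))⟩ hfin)
      (hfin.subset hsub) (hf.cartier hr) rfl
  by_cases hcyc : ∃ d r, d ≠ 0 ∧ r < 2 ^ d ∧ cartier d r f = f
  · obtain ⟨d, r, hd, hr, hfr⟩ := hcyc
    have hdecomp := sum_X_pow_mul_cartier d f
    rw [← Finset.add_sum_erase _ _ (Finset.mem_range.2 hr), hfr] at hdecomp
    refine .root r hd (.sum fun s hs => ?_) hdecomp
    obtain ⟨hsr, hs⟩ := Finset.mem_erase.1 hs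
    rw [Finset.mem_range] at hs
    refine ((hlower d s hs ?_).pow_two_pow d).X_pow_mul s
    rintro ⟨e, u, hu, hfu⟩
    rw [cartier_cartier] at hfu
    have hlt : s + 2 ^ d * u < 2 ^ (d + e) := by
      rw [pow_add]
      nlinarith
    -- Both loops are brought to length `d * (d + e)`; there they coincide, and their last `d`
    -- digits give `s = r`.
    obtain ⟨s₁, hs₁, hmod₁, hf₁⟩ := cartier_iterate hlt hfu d
    obtain ⟨s₂, hs₂, hmod₂, hf₂⟩ := cartier_iterate hr hfr (d + e)
    rw [mul_comm (d + e)] at hs₁ hf₁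
    have heq := hf.eq_of_cartier_eq h0 hs₁ hs₂ hf₁ hf₂
    apply hsr
    have h1 := congrArg (· % 2 ^ d) (hmod₁ hd)
    simp only [pow_add, Nat.mod_mul_right_mod, Nat.add_mul_mod_self_left, Nat.mod_eq_of_lt hs] at h1
    rw [← h1, heq]
    exact hmod₂ (by omega)
  · push Not at hcyc
    rw [sum_X_pow_mul_cartier 1 f]
    refine .sum fun r hr => ?_
    rw [Finset.mem_range] at hr
    refine ((hlower 1 r hr ?_).pow_two_pow 1).X_pow_mul r
    rintro ⟨e, u, hu, hfu⟩
    rw [cartier_cartier] at hfu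
    refine hcyc _ _ (by omega) ?_ hfu
    rw [pow_add]
    nlinarith

theorem inArtinSchreierTower_of_isSparse {σ : (ZMod 2)⟦X⟧}
    (halg : IsAlgebraic (RatFunc (ZMod 2)) (HahnSeries.ofPowerSeries ℤ (ZMod 2) σ))
    (hsparse : IsSparse σ) : InArtinSchreierTower σ :=
  inArtinSchreierTower_of_hasPolynomialCount (finite_twoKernel_of_isAlgebraic halg)
    hsparse.hasPolynomialCount

end SparseStructure

/-! ### Valuations with dense subfields -/

section Valuation

variable {Γ : Type*} [LinearOrderedCommGroupWithZero Γ]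

theorem valuation_le_one_of_isIntegralElem {R M : Type*} [CommRing R] [Field M] (v : Valuation M Γ)
    (φ : R →+* M) (hφ : ∀ r, v (φ r) ≤ 1) {x : M} (hx : φ.IsIntegralElem x) : v x ≤ 1 := by
  obtain ⟨p, hp, hpx⟩ := hx
  let ψ : R →+* v.integer := φ.codRestrict v.integer hφ
  have hψ : (algebraMap v.integer M).comp ψ = φ := rfl
  have h : IsIntegral v.integer x := ⟨p.map ψ, hp.map ψ, by rwa [Polynomial.eval₂_map, hψ]⟩
  exact (Valuation.integer.integers v).mem_of_integral h

/-- Over `k` the polynomial splits, and a product of values `v (x - κ c)` can be below `1` only if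
some factor is. -/
theorem exists_valuation_sub_lt_one {k M : Type*} [Field k] [IsAlgClosed k] [Field M]
    (v : Valuation M Γ) (κ : k →+* M) (hκ : ∀ c, c ≠ 0 → v (κ c) = 1) {p : Polynomial k}
    (hp : p ≠ 0) {x : M} (hpx : v (p.eval₂ κ x) < 1) : ∃ c, v (x - κ c) < 1 := by
  by_contra! h
  rw [(IsAlgClosed.splits p).eq_prod_roots, Polynomial.eval₂_mul, Polynomial.eval₂_C, map_mul,
    hκ _ (Polynomial.leadingCoeff_ne_zero.2 hp), one_mul, ← Polynomial.coe_eval₂RingHom,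
    map_multiset_prod, map_multiset_prod, Multiset.map_map, Multiset.map_map] at hpx
  refine absurd hpx (not_lt.2 (Multiset.one_le_prod ?_))
  intro y hy
  obtain ⟨c, -, rfl⟩ := Multiset.mem_map.1 hy
  simpa using h c

/-- The valuation `v` of `K` has `π` as uniformizer, is trivial on `k` and has residue field `k`. -/
structure IsRationalPlace {k K : Type*} [Field k] [Field K] (v : Valuation K Γ) (κ : k →+* K)
    (π : K) : Prop where
  map_const : ∀ c, c ≠ 0 → v (κ c) = 1
  ne_zero : π ≠ 0
  lt_one : v π < 1
  exists_pow_le : ∀ z, z ≠ 0 → ∃ n : ℕ, v π ^ n ≤ v z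
  le_of_lt_one : ∀ z, v z < 1 → v z ≤ v π
  exists_residue : ∀ z, v z ≤ 1 → ∃ c, v (z - κ c) < 1

/-- Numerator and denominator are each a power of `X - a` times a polynomial `q` with `q(a) ≠ 0`,
and `q` is congruent to the constant `q(a)`. -/
theorem ratFunc_eq_zpow_mul {k : Type*} [Field k] (v : Valuation (RatFunc k) Γ)
    (hC : ∀ c, c ≠ 0 → v (RatFunc.C c) = 1) {a : k} (ha : v (RatFunc.X - RatFunc.C a) < 1)
    {z : RatFunc k} (hz : z ≠ 0) : ∃ (n : ℤ) (u : RatFunc k) (c : k),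
      z = (RatFunc.X - RatFunc.C a) ^ n * u ∧ c ≠ 0 ∧ v (u - RatFunc.C c) < 1 ∧ v u = 1 := by
  have hunit : ∀ (u : RatFunc k) (c : k), c ≠ 0 → v (u - RatFunc.C c) < 1 → v u = 1 := by
    intro u c hc h
    rw [← hC c hc] at h ⊢
    rw [← sub_add_cancel u (RatFunc.C c)]
    exact Valuation.map_add_eq_of_lt_right _ h
  have hX : v RatFunc.X ≤ 1 := by
    rw [← sub_add_cancel RatFunc.X (RatFunc.C a)]
    refine (v.map_add _ _).trans (max_le ha.le ?_)
    by_cases h : a = 0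
    · simp [h]
    · exact (hC a h).le
  have hC' : ∀ c, v (RatFunc.C c) ≤ 1 := fun c => by
    by_cases h : c = 0
    · simp [h]
    · exact (hC c h).le
  have hpoly_le : ∀ p : Polynomial k, v (algebraMap _ (RatFunc k) p) ≤ 1 := by
    intro p
    induction p using Polynomial.induction_on' with
    | add p q hp hq => rw [map_add]; exact (v.map_add _ _).trans (max_le hp hq)
    | monomial n c =>
      rw [RatFunc.algebraMap_monomial, map_mul, map_pow]
      exact mul_le_one' (hC' c) (pow_le_one' hX n)
  have hne : RatFunc.X - RatFunc.C a ≠ 0 := by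
    rw [← RatFunc.algebraMap_X, ← RatFunc.algebraMap_C, ← map_sub]
    exact RatFunc.algebraMap_ne_zero (Polynomial.X_sub_C_ne_zero a)
  have hpoly : ∀ p : Polynomial k, p ≠ 0 → ∃ (n : ℕ) (u : RatFunc k) (c : k),
      algebraMap _ (RatFunc k) p = (RatFunc.X - RatFunc.C a) ^ n * u ∧ c ≠ 0 ∧
        v (u - RatFunc.C c) < 1 := by
    intro p hp
    obtain ⟨q, hq, hdvd⟩ := p.exists_eq_pow_rootMultiplicity_mul_and_not_dvd hp a
    rw [Polynomial.dvd_iff_isRoot] at hdvd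
    refine ⟨p.rootMultiplicity a, algebraMap _ _ q, q.eval a, ?_, hdvd, ?_⟩
    · conv_lhs => rw [hq]
      simp
    · obtain ⟨s, hs⟩ := Polynomial.X_sub_C_dvd_sub_C_eval (a := a) (p := q)
      rw [← RatFunc.algebraMap_C, ← map_sub, hs, map_mul, map_mul]
      refine mul_lt_one_of_lt_of_le ?_ (hpoly_le s)
      simpa using ha
  obtain ⟨n, u, c, hn, hc, hu⟩ := hpoly _ (RatFunc.num_ne_zero hz)
  obtain ⟨m, w, b, hm, hb, hw⟩ := hpoly _ (RatFunc.denom_ne_zero z)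
  have hu1 := hunit u c hc hu
  have hw1 := hunit w b hb hw
  have hw0 : w ≠ 0 := fun h => by simp [h] at hw1
  have hb0 : RatFunc.C b ≠ 0 := by simpa using hb
  have hlt : v (u / w - RatFunc.C (c / b)) < 1 := by
    have : u / w - RatFunc.C (c / b) =
        ((u - RatFunc.C c) * RatFunc.C b - RatFunc.C c * (w - RatFunc.C b)) / (w * RatFunc.C b) := by
      rw [map_div₀]
      field_simp
      ring
    rw [this, map_div₀, map_mul, hw1, hC b hb, mul_one, div_one]
    refine v.map_sub_lt ?_ ?_
    · rwa [map_mul, hC b hb, mul_one]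
    · rwa [map_mul, hC c hc, one_mul]
  refine ⟨n - m, u / w, c / b, ?_, div_ne_zero hc hb, hlt, hunit _ _ (div_ne_zero hc hb) hlt⟩
  conv_lhs => rw [← RatFunc.num_div_denom z]
  rw [hn, hm, zpow_sub₀ hne, zpow_natCast, zpow_natCast]
  field_simp

theorem isRationalPlace_ratFunc {k : Type*} [Field k] (v : Valuation (RatFunc k) Γ)
    (hC : ∀ c, c ≠ 0 → v (RatFunc.C c) = 1) {a : k} (ha : v (RatFunc.X - RatFunc.C a) < 1) :
    IsRationalPlace v (RatFunc.C : k →+* RatFunc k) (RatFunc.X - RatFunc.C a) := by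
  have hne : RatFunc.X - RatFunc.C a ≠ 0 := by
    rw [← RatFunc.algebraMap_X, ← RatFunc.algebraMap_C, ← map_sub]
    exact RatFunc.algebraMap_ne_zero (Polynomial.X_sub_C_ne_zero a)
  have hpos : 0 < v (RatFunc.X - RatFunc.C a) := zero_lt_iff.2 (v.ne_zero_iff.2 hne)
  refine ⟨hC, hne, ha, ?_, ?_, ?_⟩
  · intro z hz
    obtain ⟨n, u, c, rfl, hc, -, hu⟩ := ratFunc_eq_zpow_mul v hC ha hz
    refine ⟨n.toNat, ?_⟩
    rw [map_mul, hu, mul_one, map_zpow₀, ← zpow_natCast]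
    exact zpow_le_zpow_right_of_le_one₀ hpos ha.le (Int.self_le_toNat n)
  · intro z hz
    by_cases h0 : z = 0
    · simp [h0]
    obtain ⟨n, u, c, rfl, hc, -, hu⟩ := ratFunc_eq_zpow_mul v hC ha h0
    rw [map_mul, hu, mul_one, map_zpow₀] at hz ⊢
    have hn : 0 < n := by
      by_contra! h
      exact absurd hz (not_lt.2 (one_le_zpow_of_nonpos₀ hpos ha.le h))
    calc _ ≤ v (RatFunc.X - RatFunc.C a) ^ (1 : ℤ) :=
          zpow_le_zpow_right_of_le_one₀ hpos ha.le hn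
      _ = _ := zpow_one _
  · intro z hz
    by_cases h0 : z = 0
    · exact ⟨0, by simp [h0]⟩
    obtain ⟨n, u, c, rfl, hc, hu', hu⟩ := ratFunc_eq_zpow_mul v hC ha h0
    rcases lt_trichotomy n 0 with hn | rfl | hn
    · rw [map_mul, hu, mul_one, map_zpow₀] at hz
      exact absurd hz (not_le.2 (one_lt_zpow_of_neg₀ hpos ha hn))
    · exact ⟨c, by simpa using hu'⟩
    · refine ⟨0, ?_⟩
      rw [map_zero, sub_zero, map_mul, hu, mul_one, map_zpow₀]
      exact zpow_lt_one₀ hpos ha hn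

variable {K M : Type*} [Field K] [Field M] [Algebra K M] (v : Valuation M Γ)

theorem exists_le_of_forall_exists_sub_le {x : M}
    (hx : ∀ z : K, z ≠ 0 → ∃ y : K, v (x - algebraMap K M y) ≤ v (algebraMap K M z)) :
    ∃ b : K, b ≠ 0 ∧ v x ≤ v (algebraMap K M b) := by
  obtain ⟨y, hy⟩ := hx 1 one_ne_zero
  rw [map_one, map_one] at hy
  have h := v.map_add (x - algebraMap K M y) (algebraMap K M y)
  rw [sub_add_cancel] at h
  rcases le_total (v (algebraMap K M y)) 1 with h1 | h1
  · exact ⟨1, one_ne_zero, by simpa using h.trans (max_le hy h1)⟩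
  · refine ⟨y, fun h0 => ?_, h.trans (max_le (hy.trans h1) le_rfl)⟩
    rw [h0, map_zero, map_zero] at h1
    exact absurd h1 (by simp)

variable (K) in
/-- The elements of `M` that are arbitrarily well approximated by elements of `K`. -/
def approximable : Subalgebra K M where
  carrier := {x | ∀ z : K, z ≠ 0 → ∃ y : K, v (x - algebraMap K M y) ≤ v (algebraMap K M z)}
  algebraMap_mem' y _ _ := ⟨y, by simp⟩
  add_mem' {a b} ha hb z hz := by
    obtain ⟨y, hy⟩ := ha z hz
    obtain ⟨y', hy'⟩ := hb z hz
    refine ⟨y + y', ?_⟩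
    rw [map_add, add_sub_add_comm]
    exact (v.map_add _ _).trans (max_le hy hy')
  mul_mem' {a b} ha hb z hz := by
    obtain ⟨c, hc, hac⟩ := exists_le_of_forall_exists_sub_le v ha
    obtain ⟨d, hd⟩ := hb (z / c) (div_ne_zero hz hc)
    obtain ⟨e, he, hde⟩ : ∃ e : K, e ≠ 0 ∧ v (algebraMap K M d) ≤ v (algebraMap K M e) := by
      by_cases h : d = 0
      · exact ⟨1, one_ne_zero, by simp [h]⟩
      · exact ⟨d, h, le_rfl⟩
    obtain ⟨f, hf⟩ := ha (z / e) (div_ne_zero hz he)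
    refine ⟨f * d, ?_⟩
    have h : a * b - algebraMap K M (f * d) =
        a * (b - algebraMap K M d) + algebraMap K M d * (a - algebraMap K M f) := by
      rw [map_mul]
      ring
    have hc' : algebraMap K M c ≠ 0 := by simpa using hc
    have he' : algebraMap K M e ≠ 0 := by simpa using he
    rw [h]
    refine (v.map_add _ _).trans (max_le ?_ ?_)
    · rw [map_mul]
      refine (mul_le_mul' hac hd).trans_eq ?_
      rw [← map_mul, map_div₀, mul_div_cancel₀ _ hc']
    · rw [map_mul]
      refine (mul_le_mul' hde hf).trans_eq ?_
      rw [← map_mul, map_div₀, mul_div_cancel₀ _ he']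

theorem mem_approximable {x : M} : x ∈ approximable K v ↔
    ∀ z : K, z ≠ 0 → ∃ y : K, v (x - algebraMap K M y) ≤ v (algebraMap K M z) :=
  Iff.rfl

theorem exists_valuation_eq_of_mem_approximable {x : M} (hx : x ∈ approximable K v)
    (hlt : ∃ z : K, z ≠ 0 ∧ v (algebraMap K M z) < v x) :
    ∃ y : K, v x = v (algebraMap K M y) := by
  obtain ⟨z, hz, hzx⟩ := hlt
  obtain ⟨y, hy⟩ := hx z hz
  exact ⟨y, (Valuation.map_eq_of_sub_lt v (by rw [Valuation.map_sub_swap]; exact hy.trans_lt hzx)).symm⟩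

/-- Hensel's lemma for the equation `f = u f ^ q + h`: its solutions are limits of elements of `K`. -/
theorem mem_approximable_of_eq {k : Type*} [Field k] [IsAlgClosed k] [CharP M 2] {κ : k →+* K} {π : K}
    (hv : IsRationalPlace (v.comap (algebraMap K M)) κ π) {u : K}
    (hu : v (algebraMap K M u) = 1) {d : ℕ} (hd : d ≠ 0) {f h : M}
    (hf : f = algebraMap K M u * f ^ 2 ^ d + h) (hh : h ∈ approximable K v) (hh1 : v h ≤ 1) :
    f ∈ approximable K v ∧ v f ≤ 1 := by
  have hq : 1 < 2 ^ d := Nat.one_lt_two_pow hd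
  have hπ : v (algebraMap K M π) < 1 := hv.lt_one
  set q := 2 ^ d with hqd
  -- If `v f > 1`, the term `u f ^ q` strictly dominates `f`, which forces `v h > 1`.
  have hf1 : v f ≤ 1 := by
    by_contra! hlt
    have h1 : v f < v (algebraMap K M u * f ^ q) := by
      rw [map_mul, hu, one_mul, map_pow]
      exact lt_self_pow₀ hlt hq
    have h2 : v h = v (algebraMap K M u * f ^ q) := by
      rw [← Valuation.map_sub_eq_of_lt_right v h1]
      congr 1
      linear_combination -hf
    exact absurd hh1 (not_le.2 (by rw [h2]; exact hlt.trans h1))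
  refine ⟨?_, hf1⟩
  have hpow_sub : ∀ y : M, f - (algebraMap K M u * y ^ q + h) = algebraMap K M u * (f - y) ^ q := by
    intro y
    rw [hqd, sub_pow_char_pow]
    linear_combination hf
  have hsub : ∀ y : M, v (f - (algebraMap K M u * y ^ q + h)) = v (f - y) ^ q := by
    intro y
    rw [hpow_sub, map_mul, hu, one_mul, map_pow]
  have hle : ∀ x ∈ approximable K v, v x < 1 → v x ≤ v (algebraMap K M π) := by
    intro x hx hx1
    obtain ⟨y, hy⟩ := hx π hv.ne_zero
    have hy1 : v (algebraMap K M y) < 1 := by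
      rw [← sub_sub_cancel x (algebraMap K M y)]
      exact v.map_sub_lt hx1 (hy.trans_lt hπ)
    rw [← sub_add_cancel x (algebraMap K M y)]
    exact (v.map_add _ _).trans (max_le hy (hv.le_of_lt_one y hy1))
  obtain ⟨c, hc⟩ : ∃ c, v (f - algebraMap K M (κ c)) < 1 := by
    obtain ⟨b, hb⟩ := hv.exists_residue u hu.le
    obtain ⟨y, hy⟩ := hh π hv.ne_zero
    have hy1 : v (algebraMap K M y) ≤ 1 := by
      rw [← sub_sub_cancel h (algebraMap K M y)]
      exact v.map_sub_le hh1 (hy.trans hπ.le)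
    obtain ⟨e, he⟩ := hv.exists_residue y hy1
    rw [Valuation.comap_apply, map_sub] at hb he
    -- The reduction of the equation modulo the maximal ideal; its linear term makes it a nonzero
    -- polynomial.
    refine exists_valuation_sub_lt_one v ((algebraMap K M).comp κ) hv.map_const
      (p := Polynomial.C b * Polynomial.X ^ q - Polynomial.X + Polynomial.C e) ?_ ?_
    · intro h0
      have := congrArg (Polynomial.coeff · 1) h0
      simp [Polynomial.coeff_X_pow, hq.ne] at this
    · simp only [Polynomial.eval₂_add, Polynomial.eval₂_sub, Polynomial.eval₂_mul,
        Polynomial.eval₂_C, Polynomial.eval₂_X, Polynomial.eval₂_pow, RingHom.comp_apply]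
      have h0 : algebraMap K M (κ b) * f ^ q - f + algebraMap K M (κ e) =
          -((algebraMap K M u - algebraMap K M (κ b)) * f ^ q + ((h - algebraMap K M y) +
            (algebraMap K M y - algebraMap K M (κ e)))) := by
        linear_combination -hf
      rw [h0, Valuation.map_neg]
      refine v.map_add_lt ?_ (v.map_add_lt (hy.trans_lt hπ) he)
      rw [map_mul, map_pow]
      exact mul_lt_one_of_lt_of_le hb (pow_le_one' hf1 q)
  let y : ℕ → M := fun n => (fun y => algebraMap K M u * y ^ q + h)^[n] (algebraMap K M (κ c))
  have hy0 : y 0 = algebraMap K M (κ c) := rfl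
  have hysucc : ∀ n, y (n + 1) = algebraMap K M u * y n ^ q + h := fun n =>
    Function.iterate_succ_apply' _ _ _
  have hymem : ∀ n, y n ∈ approximable K v := by
    intro n
    induction n with
    | zero => exact (approximable K v).algebraMap_mem _
    | succ n ih =>
      rw [hysucc]
      exact add_mem (mul_mem ((approximable K v).algebraMap_mem _) (pow_mem ih _)) hh
  have hyval : ∀ n, v (f - y n) = v (f - y 0) ^ q ^ n := by
    intro n
    induction n with
    | zero => simp
    | succ n ih => rw [hysucc, hsub, ih, ← pow_mul, pow_succ]
  -- The valuation on `M` need not be discrete, so `< 1` does not give `≤ v π` directly. But `f - y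
  -- 0` has the same value as the approximable `y 1 - y 0`, to which discreteness on `K` applies.
  have hδ : v (f - y 0) ≤ v (algebraMap K M π) := by
    by_cases h0 : v (f - y 0) = 0
    · rw [h0]
      exact zero_le
    have h1 : v (f - y 1) < v (f - y 0) := by
      rw [hyval 1, pow_one]
      exact pow_lt_self_of_lt_one₀ (zero_lt_iff.2 h0) hc hq
    have h2 : v (f - y 0) = v (y 1 - y 0) := by
      rw [← Valuation.map_sub_eq_of_lt_left v h1]
      congr 1
      ring
    rw [h2]
    exact hle _ (sub_mem (hymem 1) (hymem 0)) (by rw [← h2]; exact hc)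
  intro z hz
  obtain ⟨n, hn⟩ := hv.exists_pow_le z hz
  obtain ⟨x, hx⟩ := hymem n z hz
  refine ⟨x, ?_⟩
  rw [← sub_add_sub_cancel f (y n)]
  refine (v.map_add _ _).trans (max_le ?_ hx)
  rw [hyval]
  calc v (f - y 0) ^ q ^ n ≤ v (algebraMap K M π) ^ q ^ n := pow_le_pow_left₀ zero_le hδ _
    _ ≤ v (algebraMap K M π) ^ n := pow_le_pow_of_le_one zero_le hπ.le (Nat.lt_pow_self hq).le
    _ ≤ _ := hn

end Valuation

/-- Every valuation ring of a field extends to any extension field. -/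
theorem exists_valuationSubring_extension {L M : Type*} [Field L] [Field M] [Algebra L M]
    (O : ValuationSubring L) : ∃ V : ValuationSubring M, ∀ x, algebraMap L M x ∈ V ↔ x ∈ O := by
  obtain ⟨V, hV, hloc⟩ := IsLocalRing.exists_factor_valuationRing ((algebraMap L M).comp O.subtype)
  refine ⟨V, fun x => ⟨fun hx => ?_, fun hx => hV ⟨x, hx⟩⟩⟩
  by_contra hnot
  have hx0 : x ≠ 0 := by
    rintro rfl
    exact hnot O.zero_mem
  have hinv : x⁻¹ ∈ O := (O.mem_or_inv_mem x).resolve_left hnot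
  have hunit : IsUnit (⟨x⁻¹, hinv⟩ : O) := by
    apply hloc.map_nonunit
    refine IsUnit.of_mul_eq_one ⟨algebraMap L M x, hx⟩ (Subtype.ext ?_)
    change algebraMap L M x⁻¹ * algebraMap L M x = 1
    rw [← map_mul, inv_mul_cancel₀ hx0, map_one]
  obtain ⟨y, hy⟩ := hunit.exists_right_inv
  have hy' : x⁻¹ * (y : L) = 1 := congrArg Subtype.val hy
  apply hnot
  rw [eq_of_inv_mul_eq_one hy']
  exact y.2

/-! ### Places of algebraic extensions of `k(t)` -/

theorem IsRationalPlace.of_isEquiv {k K Γ Γ' : Type*} [Field k] [Field K]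
    [LinearOrderedCommGroupWithZero Γ] [LinearOrderedCommGroupWithZero Γ'] {v : Valuation K Γ}
    {w : Valuation K Γ'} {κ : k →+* K} {π : K} (hv : IsRationalPlace v κ π) (h : v.IsEquiv w) :
    IsRationalPlace w κ π where
  map_const c hc := h.eq_one_iff_eq_one.1 (hv.map_const c hc)
  ne_zero := hv.ne_zero
  lt_one := h.lt_one_iff_lt_one.1 hv.lt_one
  exists_pow_le z hz := by
    obtain ⟨n, hn⟩ := hv.exists_pow_le z hz
    refine ⟨n, ?_⟩
    rw [← map_pow] at hn ⊢
    exact (h _ _).1 hn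
  le_of_lt_one z hz := (h _ _).1 (hv.le_of_lt_one z (h.lt_one_iff_lt_one.2 hz))
  exists_residue z hz := by
    obtain ⟨c, hc⟩ := hv.exists_residue z (h.le_one_iff_le_one.2 hz)
    exact ⟨c, h.lt_one_iff_lt_one.1 hc⟩

/-- Some polynomial multiple `p x⁻¹` is integral over `k[t]`, hence `v p ≤ v x`, and `π p` is
strictly smaller. -/
theorem exists_lt_valuation_of_isAlgebraic {k Γ M : Type*} [Field k]
    [LinearOrderedCommGroupWithZero Γ]
    [Field M] [Algebra (RatFunc k) M] (v : Valuation M Γ) {π : RatFunc k}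
    (hv : IsRationalPlace (v.comap (algebraMap (RatFunc k) M)) (RatFunc.C : k →+* RatFunc k) π)
    (hX : v (algebraMap (RatFunc k) M RatFunc.X) ≤ 1) {x : M} (hx : IsAlgebraic (RatFunc k) x)
    (hx0 : x ≠ 0) : ∃ z : RatFunc k, z ≠ 0 ∧ v (algebraMap (RatFunc k) M z) < v x := by
  let : Algebra (Polynomial k) M :=
    ((algebraMap (RatFunc k) M).comp (algebraMap (Polynomial k) (RatFunc k))).toAlgebra
  have : IsScalarTower (Polynomial k) (RatFunc k) M := IsScalarTower.of_algebraMap_eq fun _ => rfl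
  have halg : IsAlgebraic (Polynomial k) x⁻¹ :=
    (IsFractionRing.isAlgebraic_iff (Polynomial k) (RatFunc k) M).2 hx.inv
  obtain ⟨p, hp, hint⟩ := halg.exists_integral_multiple
  have hle : v (p • x⁻¹) ≤ 1 := by
    refine valuation_le_one_of_isIntegralElem v _ (fun r => ?_) hint
    induction r using Polynomial.induction_on' with
    | add p q hp hq => rw [map_add]; exact v.map_add_le hp hq
    | monomial n c =>
      rw [RingHom.algebraMap_toAlgebra, RingHom.comp_apply, RatFunc.algebraMap_monomial, map_mul,
        map_pow, map_mul, map_pow]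
      refine mul_le_one' ?_ (pow_le_one' hX n)
      by_cases hc : c = 0
      · simp [hc]
      · exact (hv.map_const c hc).le
  have hp0 : algebraMap (Polynomial k) (RatFunc k) p ≠ 0 := RatFunc.algebraMap_ne_zero hp
  refine ⟨π * algebraMap (Polynomial k) (RatFunc k) p, mul_ne_zero hv.ne_zero hp0, ?_⟩
  have hvx : 0 < v x := zero_lt_iff.2 (v.ne_zero_iff.2 hx0)
  rw [Algebra.smul_def, map_mul, map_inv₀, IsScalarTower.algebraMap_apply (Polynomial k) (RatFunc k) M,
    ← div_eq_mul_inv, div_le_one₀ hvx] at hle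
  rw [map_mul, map_mul]
  refine lt_of_lt_of_le ?_ hle
  refine mul_lt_of_lt_one_left (zero_lt_iff.2 (v.ne_zero_iff.2 ?_)) hv.lt_one
  simpa using hp

/-- If no nonzero polynomial had value below `1`, then `k(t)`, and by integrality `L`, would lie in
`O`. A polynomial of value below `1` splits, which gives a uniformizer `X - c`. -/
theorem exists_isRationalPlace {k L : Type*} [Field k] [IsAlgClosed k] [Field L] [Algebra (RatFunc k) L]
    [Algebra.IsAlgebraic (RatFunc k) L] {O : ValuationSubring L} (hO : IsPlace k O)
    (hX : O.valuation (algebraMap (RatFunc k) L RatFunc.X) = 1) :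
    ∃ π, IsRationalPlace (O.valuation.comap (algebraMap (RatFunc k) L))
      (RatFunc.C : k →+* RatFunc k) π := by
  set v := O.valuation.comap (algebraMap (RatFunc k) L) with hvdef
  have hC' : ∀ c, v (RatFunc.C c) ≤ 1 := fun c =>
    (O.valuation_le_one_iff _).2 (hO.1.le ⟨c, rfl⟩)
  have hC : ∀ c, c ≠ 0 → v (RatFunc.C c) = 1 := by
    intro c hc
    refine le_antisymm (hC' c) ?_
    have h := hC' c⁻¹
    rw [map_inv₀, map_inv₀] at h
    exact (inv_le_one₀ (zero_lt_iff.2 (v.ne_zero_iff.2 (by simpa using hc)))).1 h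
  obtain ⟨p, hp, hvp⟩ : ∃ p : Polynomial k, p ≠ 0 ∧ v (algebraMap _ (RatFunc k) p) < 1 := by
    by_contra! h
    apply hO.2
    rw [eq_top_iff]
    intro x _
    have hpoly : ∀ p : Polynomial k, v (algebraMap _ (RatFunc k) p) ≤ 1 := by
      intro p
      induction p using Polynomial.induction_on' with
      | add p q hp hq => rw [map_add]; exact v.map_add_le hp hq
      | monomial n c =>
        rw [RatFunc.algebraMap_monomial, map_mul, map_pow]
        exact mul_le_one' (hC' c) (pow_le_one' hX.le n)
    rw [← O.valuation_le_one_iff]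
    refine valuation_le_one_of_isIntegralElem _ (algebraMap (RatFunc k) L) (fun z => ?_)
      (Algebra.IsAlgebraic.isAlgebraic x).isIntegral
    change v z ≤ 1
    rw [← RatFunc.num_div_denom z, map_div₀]
    refine div_le_one_of_le₀ ((hpoly _).trans (h _ (RatFunc.denom_ne_zero z))) zero_le
  have heval : p.eval₂ (RatFunc.C : k →+* RatFunc k) RatFunc.X = algebraMap _ (RatFunc k) p :=
    RatFunc.aeval_X_left_eq_algebraMap p
  obtain ⟨c, hc⟩ := exists_valuation_sub_lt_one v (RatFunc.C : k →+* RatFunc k) hC hp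
    (x := RatFunc.X) (by rwa [heval])
  exact ⟨_, isRationalPlace_ratFunc v hC hc⟩

/-! ### Integrality -/

section

variable (k : Type*) [Field k] [Algebra (ZMod 2) k]

/-- `toLaurent` as a ring homomorphism. -/
def toLaurentHom : PowerSeries (ZMod 2) →+* LaurentSeries k :=
  (HahnSeries.ofPowerSeries ℤ k).comp (PowerSeries.map (algebraMap (ZMod 2) k))

theorem toLaurentHom_X : toLaurentHom k PowerSeries.X = HahnSeries.single 1 1 := by
  simp [toLaurentHom]

theorem toLaurentHom_X' : toLaurentHom k PowerSeries.X =
    algebraMap (RatFunc k) (LaurentSeries k) RatFunc.X := by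
  rw [toLaurentHom_X, algebraMap_ratFunc_X]

theorem charP_two_of_algebra (M : Type*) [Field M] [Algebra k M] : CharP M 2 := by
  have : CharP k 2 := charP_of_injective_algebraMap (algebraMap (ZMod 2) k).injective 2
  exact charP_of_injective_algebraMap (algebraMap k M).injective 2

theorem isIntegral_of_pow_eq {R S : Type*} [CommRing R] [CommRing S] [Algebra R S] {f c h : S}
    {q : ℕ} (hq : 1 < q) (hc : IsIntegral R c) (hh : IsIntegral R h) (hf : f ^ q = c * f + h) :
    IsIntegral R f := by
  have hB : IsIntegral (integralClosure R S) f := by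
    refine ⟨Polynomial.X ^ q - (Polynomial.C ⟨c, hc⟩ * Polynomial.X + Polynomial.C ⟨h, hh⟩),
      Polynomial.monic_X_pow_sub (lt_of_le_of_lt Polynomial.degree_linear_le (by exact_mod_cast hq)),
      ?_⟩
    simp only [Polynomial.eval₂_sub, Polynomial.eval₂_add, Polynomial.eval₂_mul,
      Polynomial.eval₂_C, Polynomial.eval₂_X, Polynomial.eval₂_pow]
    exact sub_eq_zero.2 hf
  exact isIntegral_trans f hB

variable {k}

/-- The base ring is left general to serve both `k[t, t⁻¹]`, for integrality, and `k(t)`, for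
algebraicity. -/
theorem InArtinSchreierTower.isIntegral_of_isIntegral_single {R : Type*} [CommRing R]
    [Algebra R (LaurentSeries k)] (hX : IsIntegral R (HahnSeries.single (1 : ℤ) (1 : k)))
    (hY : IsIntegral R (HahnSeries.single (-1 : ℤ) (1 : k)))
    {f : PowerSeries (ZMod 2)} (hf : InArtinSchreierTower f) : IsIntegral R (toLaurentHom k f) := by
  rw [← toLaurentHom_X] at hX
  have hXY : HahnSeries.single (-1 : ℤ) (1 : k) * toLaurentHom k PowerSeries.X = 1 := by
    rw [toLaurentHom_X, HahnSeries.single_mul_single]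
    simp
  induction hf with
  | zero => rw [map_zero]; exact isIntegral_zero
  | add _ _ hf hg => rw [map_add]; exact hf.add hg
  | sq _ hf => rw [map_pow]; exact hf.pow 2
  | X_mul _ hf => rw [map_mul]; exact hX.mul hf
  | @root f h a d hd _ hf hh =>
    refine isIntegral_of_pow_eq (Nat.one_lt_two_pow hd) (hY.pow a) ((hY.pow a).mul hh).neg ?_
    have h1 := congrArg (toLaurentHom k) hf
    simp only [map_add, map_mul, map_pow] at h1
    have h2 := congrArg (· ^ a) hXY
    simp only [mul_pow, one_pow] at h2
    linear_combination (-HahnSeries.single (-1 : ℤ) (1 : k) ^ a) * h1 - toLaurentHom k f ^ 2 ^ d * h2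

theorem InArtinSchreierTower.isIntegral {f : PowerSeries (ZMod 2)} (hf : InArtinSchreierTower f) :
    IsIntegral (laurentPolynomials k) (toLaurentHom k f) :=
  hf.isIntegral_of_isIntegral_single
    (isIntegral_algebraMap
      (x := (⟨_, Algebra.subset_adjoin (Set.mem_insert _ _)⟩ : laurentPolynomials k)))
    (isIntegral_algebraMap
      (x := (⟨_, Algebra.subset_adjoin (Set.mem_insert_of_mem _ rfl)⟩ : laurentPolynomials k)))

theorem InArtinSchreierTower.isAlgebraic {f : PowerSeries (ZMod 2)} (hf : InArtinSchreierTower f) :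
    IsAlgebraic (RatFunc k) (toLaurentHom k f) := by
  have hX : IsIntegral (RatFunc k) (HahnSeries.single (1 : ℤ) (1 : k)) := by
    rw [← algebraMap_ratFunc_X]
    exact isIntegral_algebraMap
  refine (hf.isIntegral_of_isIntegral_single hX ?_).isAlgebraic
  have hinv : HahnSeries.single (-1 : ℤ) (1 : k) = (HahnSeries.single (1 : ℤ) (1 : k))⁻¹ := by
    refine eq_inv_of_mul_eq_one_left ?_
    rw [HahnSeries.single_mul_single]
    simp
  rw [hinv]
  exact hX.inv

/-! ### Ramification -/

/-- The bound by `1` is carried through the induction because the Hensel step requires it of `h`. -/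
theorem InArtinSchreierTower.mem_approximable [IsAlgClosed k] {Γ : Type*} [LinearOrderedCommGroupWithZero Γ]
    (v : Valuation (LaurentSeries k) Γ) {π : RatFunc k}
    (hv : IsRationalPlace (v.comap (algebraMap (RatFunc k) (LaurentSeries k)))
      (RatFunc.C : k →+* RatFunc k) π)
    (hX : v (algebraMap (RatFunc k) (LaurentSeries k) RatFunc.X) = 1)
    {f : PowerSeries (ZMod 2)} (hf : InArtinSchreierTower f) :
    toLaurentHom k f ∈ approximable (RatFunc k) v ∧ v (toLaurentHom k f) ≤ 1 := by
  have : CharP (LaurentSeries k) 2 := charP_two_of_algebra k _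
  induction hf with
  | zero => simp
  | add _ _ hf hg =>
    rw [map_add]
    exact ⟨add_mem hf.1 hg.1, v.map_add_le hf.2 hg.2⟩
  | sq _ hf =>
    rw [map_pow, map_pow]
    exact ⟨pow_mem hf.1 2, pow_le_one' hf.2 2⟩
  | X_mul _ hf =>
    rw [map_mul, toLaurentHom_X', map_mul, hX, one_mul]
    exact ⟨mul_mem (Subalgebra.algebraMap_mem _ _) hf.1, hf.2⟩
  | @root f h a d hd _ hf hh =>
    refine mem_approximable_of_eq v hv (u := RatFunc.X ^ a) ?_ hd (h := toLaurentHom k h) ?_ hh.1 hh.2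
    · rw [map_pow, map_pow, hX, one_pow]
    · have h1 := congrArg (toLaurentHom k) hf
      simpa only [map_add, map_mul, map_pow, toLaurentHom_X'] using h1

theorem InArtinSchreierTower.isUnramifiedOutsideZeroInfty [IsAlgClosed k]
    {f : PowerSeries (ZMod 2)} (hf : InArtinSchreierTower f) :
    IsUnramifiedOutsideZeroInfty k (IntermediateField.adjoin (RatFunc k) {toLaurentHom k f}) := by
  set L := IntermediateField.adjoin (RatFunc k) {toLaurentHom k f}
  intro O hO hX
  have hL : Algebra.IsAlgebraic (RatFunc k) L := by
    have := IntermediateField.adjoin.finiteDimensional (hf.isAlgebraic (k := k)).isIntegral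
    exact Algebra.IsAlgebraic.of_finite _ _
  obtain ⟨π, hπ⟩ := exists_isRationalPlace hO hX
  -- The intermediate series of the tower need not lie in `L`, so the place is extended to all of
  -- `k((t))`.
  obtain ⟨V, hV⟩ := exists_valuationSubring_extension (M := LaurentSeries k) O
  have hle : ∀ x : L, V.valuation (x : LaurentSeries k) ≤ 1 ↔ O.valuation x ≤ 1 := by
    intro x
    rw [V.valuation_le_one_iff, O.valuation_le_one_iff]
    exact hV x
  have hequiv : (V.valuation.comap (algebraMap L (LaurentSeries k))).IsEquiv O.valuation :=
    Valuation.isEquiv_of_val_le_one fun {x} => hle x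
  have hplace : IsRationalPlace (V.valuation.comap (algebraMap (RatFunc k) (LaurentSeries k)))
      (RatFunc.C : k →+* RatFunc k) π :=
    hπ.of_isEquiv (hequiv.symm.comap (algebraMap (RatFunc k) L))
  have hXV : V.valuation (algebraMap (RatFunc k) (LaurentSeries k) RatFunc.X) = 1 :=
    hequiv.eq_one_iff_eq_one.2 hX
  have hmem := (hf.mem_approximable V.valuation hplace hXV).1
  have hLmem : ∀ x : L, (x : LaurentSeries k) ∈ approximable (RatFunc k) V.valuation := by
    intro x
    have hx : (x : LaurentSeries k) ∈ L.toSubalgebra := x.2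
    rw [IntermediateField.adjoin_simple_toSubalgebra_of_isAlgebraic hf.isAlgebraic] at hx
    exact Algebra.adjoin_le (Set.singleton_subset_iff.2 hmem) hx
  rw [ramificationIndex, Subgroup.index_eq_one, MonoidHom.range_eq_top]
  intro γ
  obtain ⟨x, hx⟩ := O.valuation_surjective γ
  have hx0 : x ≠ 0 := by
    rintro rfl
    exact γ.ne_zero (by rw [← hx, map_zero])
  have hx0' : (x : LaurentSeries k) ≠ 0 := by simpa using hx0
  obtain ⟨y, hy⟩ := exists_valuation_eq_of_mem_approximable V.valuation (hLmem x)
    (exists_lt_valuation_of_isAlgebraic V.valuation hplace hXV.le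
      ((Algebra.IsAlgebraic.isAlgebraic x).algebraMap) hx0')
  have hxy : O.valuation x = O.valuation (algebraMap (RatFunc k) L y) := hequiv.eq_iff.1 hy
  have hy0 : y ≠ 0 := by
    rintro rfl
    rw [map_zero, map_zero, hx] at hxy
    exact γ.ne_zero hxy
  exact ⟨Units.mk0 y hy0, Units.ext (by rw [← hx, hxy]; rfl)⟩

end

/-! ### Automorphisms of `2`-power order -/

section Galois

variable {F E : Type*} [Field F] [Field E] [Algebra F E]

theorem algEquiv_pow_two_pow_apply_of_le {τ : E ≃ₐ[F] E} {y : E} {m n : ℕ} (hmn : m ≤ n)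
    (h : (τ ^ 2 ^ m) y = y) : (τ ^ 2 ^ n) y = y := by
  induction n, hmn using Nat.le_induction with
  | base => exact h
  | succ n _ ih => rw [pow_succ, pow_mul, pow_two, AlgEquiv.mul_apply, ih, ih]

/-- Conjugating `τ` carries the hypothesis from `y` to every root; the roots are finite in number,
so one exponent works for all, and the Galois group acts faithfully on them. -/
theorem exists_finrank_splittingField_eq_two_pow [Normal F E] {y : E} (hsep : IsSeparable F y)
    (hy : ∀ τ : E ≃ₐ[F] E, ∃ n : ℕ, (τ ^ 2 ^ n) y = y) :
    ∃ n : ℕ, Module.finrank F (minpoly F y).SplittingField = 2 ^ n := by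
  have : Fact (((minpoly F y).map (algebraMap F E)).Splits) := ⟨Normal.splits ‹_› y⟩
  have hroot : ∀ (τ : E ≃ₐ[F] E) (x : (minpoly F y).rootSet E), ∃ n : ℕ, (τ ^ 2 ^ n) x = x := by
    intro τ x
    have hconj : IsConjRoot F x.1 y :=
      ((isConjRoot_iff_mem_minpoly_rootSet hsep.isIntegral).2 x.2).symm
    obtain ⟨ρ, hρ⟩ := (isConjRoot_iff_exists_algEquiv).1 hconj
    obtain ⟨n, hn⟩ := hy (ρ⁻¹ * τ * ρ⁻¹⁻¹)
    refine ⟨n, ?_⟩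
    rw [conj_pow, AlgEquiv.mul_apply, AlgEquiv.mul_apply, inv_inv, hρ] at hn
    have h1 := congrArg ρ hn
    rw [hρ] at h1
    exact (ρ.apply_symm_apply _).symm.trans h1
  have hgroup : IsPGroup 2 (minpoly F y).Gal := by
    intro g
    obtain ⟨τ, rfl⟩ := Polynomial.Gal.restrict_surjective (minpoly F y) E g
    choose n hn using hroot τ
    have hfin : Fintype ((minpoly F y).rootSet E) := Fintype.ofFinite _
    refine ⟨Finset.univ.sup n, ?_⟩
    apply Polynomial.Gal.galActionHom_injective (minpoly F y) E
    rw [map_one]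
    ext x
    rw [← map_pow, Polynomial.Gal.galActionHom_restrict, Equiv.Perm.one_apply]
    exact algEquiv_pow_two_pow_apply_of_le (Finset.le_sup (Finset.mem_univ x)) (hn x)
  have : Fact (Nat.Prime 2) := ⟨Nat.prime_two⟩
  obtain ⟨n, hn⟩ := IsPGroup.iff_card.1 hgroup
  exact ⟨n, by rw [← hn, Polynomial.Gal.card_of_separable hsep]⟩

/-- Once `ρ` fixes `h`, the difference `ρ f - f` solves the homogeneous equation and lies in `F`; a
translation by a constant is an involution in characteristic 2. -/
theorem algEquiv_pow_apply_eq_of_eq [CharP E 2] {d : ℕ} {u : F} {f h : E}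
    (hf : f = algebraMap F E u * f ^ 2 ^ d + h)
    (hu : ∀ δ : E, δ ≠ 0 → δ = algebraMap F E u * δ ^ 2 ^ d → δ ∈ Set.range (algebraMap F E))
    {τ : E ≃ₐ[F] E} {n : ℕ} (hτ : (τ ^ 2 ^ n) h = h) : (τ ^ 2 ^ (n + 1)) f = f := by
  set ρ := τ ^ 2 ^ n with hρ
  have h1 : ρ f = algebraMap F E u * ρ f ^ 2 ^ d + h := by
    have := congrArg ρ hf
    rwa [map_add, map_mul, map_pow, AlgEquiv.commutes, hτ] at this
  obtain ⟨c, hc⟩ : ρ f - f ∈ Set.range (algebraMap F E) := by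
    by_cases h0 : ρ f - f = 0
    · exact ⟨0, by rw [h0, map_zero]⟩
    · refine hu _ h0 ?_
      rw [sub_pow_char_pow]
      linear_combination h1 - hf
  have h2 : ρ f = f + algebraMap F E c := by rw [hc]; ring
  rw [pow_succ, pow_mul, ← hρ, pow_two, AlgEquiv.mul_apply, h2, map_add, AlgEquiv.commutes, h2,
    add_assoc, CharTwo.add_self_eq_zero, add_zero]

/-- The polynomial `u X ^ 2 ^ d - X + h` has derivative `-1`, so it is separable. -/
theorem mem_separableClosure_of_eq [CharP E 2] {d : ℕ} (hd : d ≠ 0) {u f h : E}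
    (hu : u ∈ separableClosure F E) (hh : h ∈ separableClosure F E) (hf : f = u * f ^ 2 ^ d + h) :
    f ∈ separableClosure F E := by
  have hq : 1 < 2 ^ d := Nat.one_lt_two_pow hd
  have : CharP (separableClosure F E) 2 :=
    ((algebraMap (separableClosure F E) E).charP_iff
      (algebraMap (separableClosure F E) E).injective 2).2 ‹_›
  set p : Polynomial (separableClosure F E) :=
    Polynomial.C ⟨u, hu⟩ * Polynomial.X ^ 2 ^ d - Polynomial.X + Polynomial.C ⟨h, hh⟩ with hp
  have hder : Polynomial.derivative p = -1 := by
    have h2 : ((2 ^ d : ℕ) : Polynomial (separableClosure F E)) = 0 := by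
      rw [Nat.cast_pow, CharP.cast_eq_zero, zero_pow hd]
    simp only [hp, Polynomial.derivative_add, Polynomial.derivative_sub, Polynomial.derivative_mul,
      Polynomial.derivative_C, Polynomial.derivative_X_pow, Polynomial.derivative_X, map_natCast, h2]
    ring
  have hsep : p.Separable := by
    rw [Polynomial.separable_def, hder]
    exact isCoprime_one_right.neg_right
  have heval : Polynomial.aeval f p = 0 := by
    simp only [hp, map_add, map_sub, map_mul, map_pow, Polynomial.aeval_C, Polynomial.aeval_X]
    change u * f ^ 2 ^ d - f + h = 0
    linear_combination -hf
  have hmem : f ∈ separableClosure (separableClosure F E) E :=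
    mem_separableClosure_iff.2 (hsep.of_dvd (minpoly.dvd _ _ heval))
  rw [separableClosure.separableClosure_eq_bot, IntermediateField.mem_bot] at hmem
  obtain ⟨x, rfl⟩ := hmem
  exact x.2

end Galois

/-! ### Odd roots of powers of `t` -/

section OddRoots

variable (k : Type*) [Field k]

theorem algebraMap_mem_oddRootField (x : RatFunc k) :
    algebraMap (RatFunc k) (AlgebraicClosure (LaurentSeries k)) x ∈ oddRootField k :=
  (oddRootField k).algebraMap_mem x

theorem mem_oddRootField_of_pow_eq [IsAlgClosed k] {x : AlgebraicClosure (LaurentSeries k)} {l a : ℕ}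
    (hl : Odd l)
    (hx : x ^ l = algebraMap (RatFunc k) (AlgebraicClosure (LaurentSeries k)) RatFunc.X ^ a) :
    x ∈ oddRootField k := by
  classical
  have hl0 : l ≠ 0 := fun h => by simp [h] at hl
  obtain ⟨s, hs⟩ := IsAlgClosed.exists_pow_nat_eq
    (algebraMap (RatFunc k) (AlgebraicClosure (LaurentSeries k)) RatFunc.X) hl.pos
  have hsmem : s ∈ oddRootField k :=
    (mem_oddRootField k s).2 ⟨l, hl, IntermediateField.subset_adjoin _ _ hs⟩
  have hs0 : s ≠ 0 := by
    rintro rfl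
    rw [zero_pow hl0] at hs
    exact (map_ne_zero _).2 RatFunc.X_ne_zero hs.symm
  have hζ : (x / s ^ a) ^ l = 1 := by
    rw [div_pow, hx, ← pow_mul, mul_comm, pow_mul, hs, div_self]
    rw [← hs]
    exact pow_ne_zero _ (pow_ne_zero _ hs0)
  let κ := (algebraMap (RatFunc k) (AlgebraicClosure (LaurentSeries k))).comp
    (RatFunc.C : k →+* RatFunc k)
  -- For the trivial valuation, value below `1` means zero; this shows that the root of unity `x / s
  -- ^ a` lies in `k`.
  obtain ⟨c, hc⟩ := exists_valuation_sub_lt_one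
    (1 : Valuation (AlgebraicClosure (LaurentSeries k)) (WithZero (Multiplicative ℤ))) κ
    (fun c hc => Valuation.one_apply_of_ne_zero ((map_ne_zero κ).2 hc))
    (p := Polynomial.X ^ l - 1) (Polynomial.X_pow_sub_C_ne_zero hl.pos 1) (x := x / s ^ a)
    (by simp [hζ])
  rw [Valuation.one_apply_lt_one_iff, sub_eq_zero] at hc
  rw [← div_mul_cancel₀ x (pow_ne_zero a hs0), hc]
  exact mul_mem (algebraMap_mem_oddRootField k _) (pow_mem hsmem a)

end OddRoots

/-! ### Separability and automorphisms along the tower -/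

section Tower

variable (k : Type*) [Field k] [Algebra (ZMod 2) k]

/-- A power series over `𝔽₂` as an element of an algebraic closure of `k((t))`. -/
def toClosure : PowerSeries (ZMod 2) →+* AlgebraicClosure (LaurentSeries k) :=
  (algebraMap (LaurentSeries k) _).comp (toLaurentHom k)

theorem toClosure_X : toClosure k PowerSeries.X =
    algebraMap (RatFunc k) (AlgebraicClosure (LaurentSeries k)) RatFunc.X := by
  rw [toClosure, RingHom.comp_apply, toLaurentHom_X']
  rfl

variable {k}

theorem InArtinSchreierTower.mem_separableClosure {f : PowerSeries (ZMod 2)}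
    (hf : InArtinSchreierTower f) : toClosure k f ∈
      separableClosure (oddRootField k) (AlgebraicClosure (LaurentSeries k)) := by
  have : CharP (AlgebraicClosure (LaurentSeries k)) 2 := charP_two_of_algebra k _
  have hX : toClosure k PowerSeries.X ∈
      separableClosure (oddRootField k) (AlgebraicClosure (LaurentSeries k)) := by
    rw [toClosure_X]
    exact (separableClosure (oddRootField k) (AlgebraicClosure (LaurentSeries k))).algebraMap_mem
      ⟨_, algebraMap_mem_oddRootField k RatFunc.X⟩
  induction hf with
  | zero => rw [map_zero]; exact zero_mem _
  | add _ _ hf hg => rw [map_add]; exact add_mem hf hg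
  | sq _ hf => rw [map_pow]; exact pow_mem hf 2
  | X_mul _ hf => rw [map_mul]; exact mul_mem hX hf
  | @root f h a d hd _ hf hh =>
    refine mem_separableClosure_of_eq hd (pow_mem hX a) hh ?_
    have h1 := congrArg (toClosure k) hf
    simpa only [map_add, map_mul, map_pow] using h1

theorem InArtinSchreierTower.exists_algEquiv_pow_apply_eq [IsAlgClosed k]
    {E : IntermediateField (oddRootField k) (AlgebraicClosure (LaurentSeries k))}
    (hE : separableClosure (oddRootField k) (AlgebraicClosure (LaurentSeries k)) ≤ E)
    (τ : E ≃ₐ[oddRootField k] E) {f : PowerSeries (ZMod 2)} (hf : InArtinSchreierTower f) :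
    ∃ n : ℕ, (τ ^ 2 ^ n) ⟨toClosure k f, hE hf.mem_separableClosure⟩ =
      ⟨toClosure k f, hE hf.mem_separableClosure⟩ := by
  have hΩ : CharP (AlgebraicClosure (LaurentSeries k)) 2 := charP_two_of_algebra k _
  have : CharP E 2 := ((algebraMap E (AlgebraicClosure (LaurentSeries k))).charP_iff (algebraMap E _).injective 2).2 hΩ
  let u : oddRootField k := ⟨_, algebraMap_mem_oddRootField k RatFunc.X⟩
  induction hf with
  | zero =>
    refine ⟨0, ?_⟩
    have : (⟨toClosure k 0, hE InArtinSchreierTower.zero.mem_separableClosure⟩ : E) = 0 :=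
      Subtype.ext (map_zero _)
    rw [this, map_zero]
  | @add f g hf hg ihf ihg =>
    obtain ⟨m, hm⟩ := ihf
    obtain ⟨n, hn⟩ := ihg
    refine ⟨max m n, ?_⟩
    have : (⟨toClosure k (f + g), hE (hf.add hg).mem_separableClosure⟩ : E) =
        ⟨toClosure k f, hE hf.mem_separableClosure⟩ + ⟨toClosure k g, hE hg.mem_separableClosure⟩ :=
      Subtype.ext (map_add _ _ _)
    rw [this, map_add, algEquiv_pow_two_pow_apply_of_le (le_max_left m n) hm,
      algEquiv_pow_two_pow_apply_of_le (le_max_right m n) hn]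
  | @sq f hf ihf =>
    obtain ⟨n, hn⟩ := ihf
    refine ⟨n, ?_⟩
    have : (⟨toClosure k (f ^ 2), hE hf.sq.mem_separableClosure⟩ : E) =
        ⟨toClosure k f, hE hf.mem_separableClosure⟩ ^ 2 := Subtype.ext (map_pow _ _ _)
    rw [this, map_pow, hn]
  | @X_mul f hf ihf =>
    obtain ⟨n, hn⟩ := ihf
    refine ⟨n, ?_⟩
    have : (⟨toClosure k (PowerSeries.X * f), hE hf.X_mul.mem_separableClosure⟩ : E) =
        algebraMap (oddRootField k) E u * ⟨toClosure k f, hE hf.mem_separableClosure⟩ :=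
      Subtype.ext ((map_mul (toClosure k) _ _).trans (congrArg (· * _) (toClosure_X k)))
    rw [this, map_mul, AlgEquiv.commutes, hn]
  | @root f h a d hd hh hf ihh =>
    obtain ⟨n, hn⟩ := ihh
    refine ⟨n + 1, ?_⟩
    refine algEquiv_pow_apply_eq_of_eq (d := d) (u := u ^ a)
      (h := ⟨toClosure k h, hE hh.mem_separableClosure⟩) ?_ ?_ hn
    · apply Subtype.ext
      have h1 := congrArg (toClosure k) hf
      simp only [map_add, map_mul, map_pow, toClosure_X] at h1
      exact h1
    · intro δ hδ heq
      have hδ' : (δ : AlgebraicClosure (LaurentSeries k)) ≠ 0 := by simpa using hδ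
      have heq' : (δ : AlgebraicClosure (LaurentSeries k)) =
          algebraMap (RatFunc k) _ RatFunc.X ^ a * (δ : AlgebraicClosure (LaurentSeries k)) ^ 2 ^ d := by
        have := congrArg (algebraMap E (AlgebraicClosure (LaurentSeries k))) heq
        rw [map_mul, map_pow, map_pow, map_pow] at this
        exact this
      -- Cancelling one `δ` leaves the exponent `2 ^ d - 1`, odd because `d ≠ 0`; this is why odd
      -- roots of `t` suffice.
      have hinv : ((δ : AlgebraicClosure (LaurentSeries k))⁻¹) ^ (2 ^ d - 1) =
          algebraMap (RatFunc k) _ RatFunc.X ^ a := by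
        have hsplit : (δ : AlgebraicClosure (LaurentSeries k)) ^ 2 ^ d =
            (δ : AlgebraicClosure (LaurentSeries k)) ^ (2 ^ d - 1) * δ := by
          rw [← pow_succ, Nat.sub_add_cancel Nat.one_le_two_pow]
        rw [hsplit, ← mul_assoc] at heq'
        have h1 := mul_right_cancel₀ hδ' ((one_mul _).trans heq')
        rw [inv_pow]
        exact (eq_inv_of_mul_eq_one_left h1.symm).symm
      have hodd : Odd (2 ^ d - 1) :=
        Nat.Even.sub_odd Nat.one_le_two_pow ((Nat.even_pow.2 ⟨even_two, hd⟩)) odd_one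
      have hmem := inv_mem (mem_oddRootField_of_pow_eq k hodd hinv)
      rw [inv_inv] at hmem
      exact ⟨⟨_, hmem⟩, Subtype.ext rfl⟩

end Tower

end SparseSeries

end

theorem mainTheorem8 (k : Type*) [Field k] [Algebra (ZMod 2) k] [IsAlgClosure (ZMod 2) k]
    (σ : PowerSeries (ZMod 2)) (hσ : SparseSeries.IsNottingham σ)
    (halg : IsAlgebraic (RatFunc (ZMod 2)) (HahnSeries.ofPowerSeries ℤ (ZMod 2) σ))
    (hsparse : SparseSeries.IsSparse σ) :
    IsIntegral (SparseSeries.laurentPolynomials k) (SparseSeries.toLaurent k σ) ∧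
    SparseSeries.IsUnramifiedOutsideZeroInfty k
      (IntermediateField.adjoin (RatFunc k) {SparseSeries.toLaurent k σ}) ∧
    ∃ n : ℕ, Module.finrank (SparseSeries.oddRootField k)
      (minpoly (SparseSeries.oddRootField k)
        (algebraMap (LaurentSeries k) (AlgebraicClosure (LaurentSeries k))
          (SparseSeries.toLaurent k σ))).SplittingField = 2 ^ n := by
  have hk : IsAlgClosed k := IsAlgClosure.isAlgClosed (ZMod 2)
  have htower := SparseSeries.inArtinSchreierTower_of_isSparse halg hsparse
  refine ⟨htower.isIntegral, htower.isUnramifiedOutsideZeroInfty, ?_⟩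
  let Ω := AlgebraicClosure (LaurentSeries k)
  have hle : separableClosure (SparseSeries.oddRootField k) Ω ≤
    algebraicClosure (SparseSeries.oddRootField k) Ω := 
      fun x hx => mem_algebraicClosure_iff.2 (mem_separableClosure_iff.1 hx).isIntegral.isAlgebraic
  have hsep := mem_separableClosure_iff.1 (htower.mem_separableClosure (k := k))
  have hmem := hle htower.mem_separableClosure
  -- The ambient `Ω` is not algebraic over `oddRootField k`, so the argument takes place in the
  -- relative algebraic closure, which is normal and leaves the minimal polynomial unchanged.
  have hnormal : Normal (SparseSeries.oddRootField k)
      (algebraicClosure (SparseSeries.oddRootField k) Ω) := IsAlgClosure.normal _ _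
  have hmin := minpoly.algebraMap_eq (A := SparseSeries.oddRootField k)
    (algebraMap (algebraicClosure (SparseSeries.oddRootField k) Ω) Ω).injective
    ⟨SparseSeries.toClosure k σ, hmem⟩
  have h := SparseSeries.exists_finrank_splittingField_eq_two_pow (F := SparseSeries.oddRootField k)
    (y := (⟨SparseSeries.toClosure k σ, hmem⟩ : algebraicClosure (SparseSeries.oddRootField k) Ω))
    (by rw [IsSeparable, ← hmin]; exact hsep)
    (fun τ => htower.exists_algEquiv_pow_apply_eq hle τ)
  rw [← hmin] at h
  exact h
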